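/- Let $\mathfrak{S}_n$ be the group of permutations of $\{1,\dots,n\}$, with $(vu)(i)=v(u(i))$, simple transpositions $s_i=(i\;\,i+1)$ and length $\ell(w)$ the least number of simple transpositions with product $w$. Order $\mathfrak{S}_n$ by weak order: $u\le w$ if $w=us_{i_1}\cdots s_{i_m}$ for some simple transpositions with $\ell(us_{i_1}\cdots s_{i_r})=\ell(u)+r$ for all $1\le r\le m$. This is a semidistributive lattice. Label each cover relation $x\lessdot y$ by the join-irreducible element $\gamma(x\lessdot y)=\min\{z : x\vee z=y\}$, and put $D(y)=\{\gamma(x\lessdot y) : x\lessdot y\}$ and $U(y)=\{\gamma(y\lessdot z) : y\lessdot z\}$. Rowmotion $\mathrm{row}\colon\mathfrak{S}_n\to\mathfrak{S}_n$ is the map sending $y$ to the unique $x$ with $D(x)=U(y)$. For a join-irreducible $p$ let $\mathcal{T}^-_p(y)=1$ if $p$ can be toggled out of $y$, i.e. if $\gamma(x\lessdot y)=p$ for some $x\lessdot y$, and $\mathcal{T}^-_p(y)=0$ otherwise. For $1\le i<j\le n$ and $\mathbf{x}=\{x_1<\dots<x_m\}\subseteq\{i+1,\dots,j-1\}$ with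 complement $\{y_1<\dots<y_r\}$ in $\{i+1,\dots,j-1\}$, let $g((i,j),\mathbf{x})$ be the join-irreducible permutation with one-line notation $1,\dots,i-1,x_1,\dots,x_m,j,i,y_1,\dots,y_r,j+1,\dots,n$, and set $\mathcal{T}^-_{(i,j)}=\sum_{\mathbf{x}}\mathcal{T}^-_{g((i,j),\mathbf{x})}$. For $1\le k<n$ define $$f_k=\sum_{j=1}^{k}\mathcal{T}^-_{(j,k+1)}+\sum_{j=k+1}^{n}\mathcal{T}^-_{(k,j)}.$$ **Theorem.** Rowmotion on $\mathfrak{S}_n$ is well defined (for every $y$ there is exactly one $x$ with $D(x)=U(y)$), and for every $1\le k<n$: 1. $f_k$ is $1$-mesic with respect to rowmotion on $\mathfrak{S}_n$; that is, $\mathrm{row}$ is a bijection and the average of $f_k$ along every orbit of $\mathrm{row}$ is $1$. 2. For every orbit $\mathcal{O}$ of $\mathrm{row}$, with the convention $w(0)=0$ and $w(n+1)=n+1$ for all $w\in\mathfrak{S}_n$, $$\#\{w\in\mathcal{O} : w(w^{-1}(k)-1)>k\}=\#\{w\in\mathcal{O} : w(w^{-1}(k+1)+1)>k+1\}.$$ In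 words: the number of $w\in\mathcal{O}$ in which the letter $k$ forms a descent with the letter to its left equals the number of $w\in\mathcal{O}$ in which the letter $k+1$ forms an ascent with the letter to its right. -/

import Mathlib

/-! ### Edge labels, toggles and rowmotion in a finite (semidistributive) lattice

Joins are expressed through `IsLUB`, so these definitions make sense in any partial order. -/

section Lattice

variable {L : Type*} [PartialOrder L]

/-- `x ⋖ y` is a cover relation and `p` is its canonical label, the minimum of
`{z | x ∨ z = y}`. -/
def IsEdgeLabel (x y p : L) : Prop :=
  x ⋖ y ∧ IsLeast {z : L | IsLUB {x, z} y} p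

/-- `p` is join-irreducible: it covers exactly one element. -/
def IsJoinIrr (p : L) : Prop := ∃! q : L, q ⋖ p

/-- The set of labels of the edges going down from `y`. -/
def downLabels (y : L) : Set L := {p | ∃ x, IsEdgeLabel x y p}

/-- The set of labels of the edges going up from `y`. -/
def upLabels (y : L) : Set L := {p | ∃ z, IsEdgeLabel y z p}

open Classical in
/-- Rowmotion: `rowmotion y` is the (unique) `x` with `downLabels x = upLabels y`.
(The value `y` is used only if there is no such `x`.) -/
noncomputable def rowmotion (y : L) : L :=
  if h : ∃ x : L, downLabels x = upLabels y then h.choose else y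

open Classical in
/-- Toggling at `p`: move along the edge at `y` labelled by `p`, if there is one. -/
noncomputable def toggle (p y : L) : L :=
  if h : ∃ x, IsEdgeLabel x y p then h.choose
  else if h : ∃ z, IsEdgeLabel y z p then h.choose
  else y

open Classical in
/-- The toggleability statistic `𝒯⁻_p`: it is `1` at `y` if `p` can be toggled out of `y`,
and `0` otherwise. -/
noncomputable def toggleOut (p y : L) : ℤ := if toggle p y ⋖ y then 1 else 0

end Lattice

/-! ### Orbits and homomesy -/

section Homomesy

variable {X : Type*}

/-- `O` is an orbit of `Φ`. (When `Φ` is a bijection of a finite set, the forward orbit of a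
point is its whole orbit.) -/
def IsOrbit (Φ : X → X) (O : Finset X) : Prop :=
  ∃ x : X, ∀ y : X, y ∈ O ↔ ∃ m : ℕ, Φ^[m] x = y

/-- `f` is `c`-mesic with respect to the invertible operator `Φ` on the finite set `X`: the
average of `f` along every orbit of `Φ` is `c`. -/
structure IsMesic [Finite X] (Φ : X → X) (f : X → ℝ) (c : ℝ) : Prop where
  bijective : Function.Bijective Φ
  average : ∀ O : Finset X, IsOrbit Φ O → (∑ y ∈ O, f y) / (O.card : ℝ) = c

end Homomesy

/-! ### Weak order on the symmetric group

The symmetric group on `{1, …, n}` is `Equiv.Perm (Fin n)`, the number `a` corresponding to the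
element of `Fin n` with value `a - 1`. -/

section WeakOrder

variable {n : ℕ}

/-- `s` is a simple transposition, exchanging two consecutive numbers. -/
def IsSimpleTransposition (s : Equiv.Perm (Fin n)) : Prop :=
  ∃ i j : Fin n, (j : ℕ) = (i : ℕ) + 1 ∧ s = Equiv.swap i j

/-- The length of `w`: the least length of an expression of `w` as a product of simple
transpositions. -/
noncomputable def permLength (w : Equiv.Perm (Fin n)) : ℕ :=
  sInf {m : ℕ | ∃ l : List (Equiv.Perm (Fin n)),
    (∀ s ∈ l, IsSimpleTransposition s) ∧ l.prod = w ∧ l.length = m}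

/-- `v = u s` for a simple transposition `s`, with `v` one longer than `u`. -/
def WeakStep (u v : Equiv.Perm (Fin n)) : Prop :=
  ∃ s, IsSimpleTransposition s ∧ v = u * s ∧ permLength v = permLength u + 1

theorem permLength_le_of_steps {u v : Equiv.Perm (Fin n)}
    (h : Relation.ReflTransGen WeakStep u v) : u = v ∨ permLength u < permLength v := by
  induction h with
  | refl => exact Or.inl rfl
  | tail _ hs ih =>
    obtain ⟨s, -, -, hl⟩ := hs
    rcases ih with rfl | ih
    · right; omega
    · right; omega

/-- (Right) weak order: `u ≤ w` if `w = u s₁ ⋯ s_m` for simple transpositions `s₁, …, s_m`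
such that each successive multiplication increases the length by one. -/
instance weakOrder (n : ℕ) : PartialOrder (Equiv.Perm (Fin n)) where
  le := Relation.ReflTransGen WeakStep
  le_refl _ := Relation.ReflTransGen.refl
  le_trans _ _ _ := Relation.ReflTransGen.trans
  le_antisymm u v huv hvu := by
    rcases permLength_le_of_steps huv with h | h
    · exact h
    · rcases permLength_le_of_steps hvu with h' | h'
      · exact h'.symm
      · omega

/-- `w` as a map on numbers, in the numbering from `1`: for `1 ≤ a ≤ n` this is `w(a)`, and
outside this range it is `a` itself. In particular `w(0) = 0` and `w(n + 1) = n + 1`. -/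
def permVal (w : Equiv.Perm (Fin n)) (a : ℕ) : ℕ :=
  if h : 1 ≤ a ∧ a ≤ n then (w ⟨a - 1, by omega⟩ : ℕ) + 1 else a

/-- The one-line notation `w(1), w(2), …, w(n)`. -/
def oneLine (w : Equiv.Perm (Fin n)) : List ℕ := List.ofFn fun a : Fin n => (w a : ℕ) + 1

/-- The one-line notation
`1, …, i - 1, x₁, …, x_m, j, i, y₁, …, y_r, j + 1, …, n`
of the Grassmannian permutation `g((i,j), x)`, where `x₁ < ⋯ < x_m` are the elements of
`x ⊆ {i + 1, …, j - 1}` and `y₁ < ⋯ < y_r` are the elements of its complement. -/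
def grassWord (n i j : ℕ) (x : Finset ℕ) : List ℕ :=
  List.range' 1 (i - 1) ++ x.sort ++ [j, i] ++ (Finset.Ioo i j \ x).sort
    ++ List.range' (j + 1) (n - j)

open Classical in
/-- The statistic `𝒯⁻_{(i,j)}`: the sum of `𝒯⁻_p` over the join-irreducible `p` of the form
`g((i,j), x)` with `x ⊆ {i + 1, …, j - 1}`. -/
noncomputable def toggleOutPair (i j : ℕ) (w : Equiv.Perm (Fin n)) : ℤ :=
  ∑ p : Equiv.Perm (Fin n) with
    IsJoinIrr p ∧ ∃ x ⊆ Finset.Ioo i j, oneLine p = grassWord n i j x, toggleOut p w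

/-- The statistic `f_k = ∑_{j=1}^{k} 𝒯⁻_{(j,k+1)} + ∑_{j=k+1}^{n} 𝒯⁻_{(k,j)}`. -/
noncomputable def refinedDownDegree (k : ℕ) (w : Equiv.Perm (Fin n)) : ℤ :=
  ∑ j ∈ Finset.Icc 1 k, toggleOutPair j (k + 1) w
    + ∑ j ∈ Finset.Icc (k + 1) n, toggleOutPair k j w

end WeakOrder

/-! ### One-line values and inversions -/

section Inversions

variable {n : ℕ}

/-! Weak order is inclusion of inversion sets (`weak_le_iff`). A cover exchanges adjacent letters `a
< b`, and its label depends only on the arc `(a, b, S)`, where `S` is the set of letters of value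
strictly between `a` and `b` standing to their left (`isLeast_label`). So `downLabels` and
`upLabels` may be replaced by the arcs of descents and of ascents, and rowmotion sends `y` to the
`x` with `darcs x = uarcs y` (`downLabels_eq_upLabels_iff`).

Uniqueness of `x`: descent arcs recover the inversions (`invs_subset_of_darcs_subset`); the same
argument for ascents makes rowmotion injective. Existence: reverse each ascending run of `y`, so
that ascent arcs become arcs inside descending blocks, then reorder the blocks. Exchanging two
neighbouring blocks whose values are separated preserves all arcs, and a lexicographically least
arrangement has an ascent at each block boundary, so it has no further descents
(`exists_descArcs_eq_ascArcs`).

For the homomesy, write `P` and `Q` for the positions of `k` and `k + 1` in `w`. The statistic minus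
`1` equals `[w(P - 1) > k] - [w(Q + 1) > k]`. This is a telescoping sum over the edges between those
two places, and an edge contributes only if it crosses between values at most `k` and values above
`k`. Whether an edge lies in the range can be read from its arc, so `arcWeight` expresses the
difference as a sum over ascent arcs minus a sum over descent arcs (`sum_uarcs_sub_sum_darcs`). As
rowmotion turns ascent arcs into descent arcs, the two sums cancel over an orbit. The second claim
rewrites this average by complementation. -/

theorem permVal_of_mem (w : Equiv.Perm (Fin n)) {a : ℕ} (h : 1 ≤ a ∧ a ≤ n) :
    permVal w a = (w ⟨a - 1, by omega⟩ : ℕ) + 1 := dif_pos h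

theorem permVal_of_not_mem (w : Equiv.Perm (Fin n)) {a : ℕ} (h : ¬(1 ≤ a ∧ a ≤ n)) :
    permVal w a = a := dif_neg h

theorem permVal_fin (w : Equiv.Perm (Fin n)) (i : Fin n) :
    permVal w ((i : ℕ) + 1) = (w i : ℕ) + 1 := by
  rw [permVal_of_mem w (by omega)]; rfl

theorem permVal_mem_iff (w : Equiv.Perm (Fin n)) (a : ℕ) :
    (1 ≤ permVal w a ∧ permVal w a ≤ n) ↔ (1 ≤ a ∧ a ≤ n) := by
  by_cases h : 1 ≤ a ∧ a ≤ n
  · rw [permVal_of_mem w h]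
    have := (w ⟨a - 1, by omega⟩).isLt
    exact ⟨fun _ => h, fun _ => by omega⟩
  · rw [permVal_of_not_mem w h]

theorem permVal_mul (u v : Equiv.Perm (Fin n)) (a : ℕ) :
    permVal (u * v) a = permVal u (permVal v a) := by
  by_cases h : 1 ≤ a ∧ a ≤ n
  · rw [permVal_of_mem v h, permVal_fin, permVal_of_mem _ h]; rfl
  · rw [permVal_of_not_mem v h, permVal_of_not_mem u h, permVal_of_not_mem _ h]

@[simp] theorem permVal_one (a : ℕ) : permVal (1 : Equiv.Perm (Fin n)) a = a := by
  by_cases h : 1 ≤ a ∧ a ≤ n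
  · rw [permVal_of_mem _ h]; simp; omega
  · rw [permVal_of_not_mem _ h]

@[simp] theorem permVal_apply_inv (w : Equiv.Perm (Fin n)) (a : ℕ) :
    permVal w (permVal w⁻¹ a) = a := by
  rw [← permVal_mul]; simp

@[simp] theorem permVal_inv_apply (w : Equiv.Perm (Fin n)) (a : ℕ) :
    permVal w⁻¹ (permVal w a) = a := by
  rw [← permVal_mul]; simp

theorem permVal_injective (w : Equiv.Perm (Fin n)) : Function.Injective (permVal w) :=
  Function.LeftInverse.injective (permVal_inv_apply w)

theorem permVal_eq_iff (w : Equiv.Perm (Fin n)) (a b : ℕ) :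
    permVal w a = b ↔ a = permVal w⁻¹ b := by
  constructor
  · rintro rfl; simp
  · rintro rfl; simp

theorem permVal_ext {u w : Equiv.Perm (Fin n)} (h : ∀ a, permVal u a = permVal w a) : u = w := by
  ext i
  have := h (i + 1)
  rw [permVal_fin, permVal_fin] at this
  omega

@[simp] theorem permVal_zero (w : Equiv.Perm (Fin n)) : permVal w 0 = 0 :=
  permVal_of_not_mem w (by omega)

theorem permVal_gt (w : Equiv.Perm (Fin n)) {a : ℕ} (h : n < a) : permVal w a = a :=
  permVal_of_not_mem w (by omega)

theorem permVal_pos (w : Equiv.Perm (Fin n)) {a : ℕ} (h : 1 ≤ a) : 1 ≤ permVal w a := by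
  rcases Nat.eq_zero_or_pos (permVal w a) with h0 | h0
  · rw [permVal_eq_iff] at h0; simp at h0; omega
  · exact h0

theorem permVal_le (w : Equiv.Perm (Fin n)) {a : ℕ} (h : a ≤ n) : permVal w a ≤ n := by
  rcases Nat.eq_zero_or_pos a with rfl | h0
  · simp
  · exact ((permVal_mem_iff w a).2 ⟨h0, h⟩).2

theorem permVal_swap (i j : Fin n) (a : ℕ) :
    permVal (Equiv.swap i j) a = Equiv.swap ((i : ℕ) + 1) (j + 1) a := by
  by_cases h : 1 ≤ a ∧ a ≤ n
  · rw [permVal_of_mem _ h, Equiv.swap_apply_def, Equiv.swap_apply_def]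
    simp only [Fin.ext_iff]
    split_ifs <;> (try simp) <;> omega
  · rw [permVal_of_not_mem _ h, Equiv.swap_apply_of_ne_of_ne] <;> omega

theorem isSimpleTransposition_iff {s : Equiv.Perm (Fin n)} :
    IsSimpleTransposition s ↔
      ∃ m, 1 ≤ m ∧ m < n ∧ ∀ a, permVal s a = Equiv.swap m (m + 1) a := by
  constructor
  · rintro ⟨i, j, hij, rfl⟩
    refine ⟨i + 1, by omega, by omega, fun a => ?_⟩
    rw [permVal_swap, hij]
  · rintro ⟨m, h1, h2, h⟩
    refine ⟨⟨m - 1, by omega⟩, ⟨m, h2⟩, (Nat.sub_add_cancel h1).symm, permVal_ext fun a => ?_⟩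
    rw [h, permVal_swap, Nat.sub_add_cancel h1]

theorem exists_simpleTransposition {m : ℕ} (h1 : 1 ≤ m) (h2 : m < n) :
    ∃ s : Equiv.Perm (Fin n), IsSimpleTransposition s ∧
      ∀ a, permVal s a = Equiv.swap m (m + 1) a := by
  have h : ∀ a, permVal (Equiv.swap (⟨m - 1, by omega⟩ : Fin n) ⟨m, h2⟩) a =
      Equiv.swap m (m + 1) a := by
    intro a
    rw [permVal_swap, Nat.sub_add_cancel h1]
  exact ⟨_, isSimpleTransposition_iff.2 ⟨m, h1, h2, h⟩, h⟩

/-- The inversions of `w`, as pairs of values `a < b` with `b` to the left of `a`. -/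
def invs (w : Equiv.Perm (Fin n)) : Finset (ℕ × ℕ) :=
  (Finset.Icc 1 n ×ˢ Finset.Icc 1 n).filter
    fun p => p.1 < p.2 ∧ permVal w⁻¹ p.2 < permVal w⁻¹ p.1

theorem mem_invs {w : Equiv.Perm (Fin n)} {a b : ℕ} :
    (a, b) ∈ invs w ↔ a < b ∧ permVal w⁻¹ b < permVal w⁻¹ a := by
  simp only [invs, Finset.mem_filter, Finset.mem_product, Finset.mem_Icc, and_iff_right_iff_imp]
  rintro ⟨h1, h2⟩
  have ha : 1 ≤ a := by
    rcases Nat.eq_zero_or_pos a with rfl | h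
    · simp at h2
    · exact h
  have hb : b ≤ n := by
    by_contra hb
    rw [permVal_gt w⁻¹ (by omega : n < b)] at h2
    by_cases h : a ≤ n
    · have := permVal_le w⁻¹ h; omega
    · rw [permVal_gt w⁻¹ (by omega : n < a)] at h2; omega
  omega

theorem bounds_of_mem_invs {w : Equiv.Perm (Fin n)} {a b : ℕ} (h : (a, b) ∈ invs w) :
    1 ≤ a ∧ a < b ∧ b ≤ n := by
  simp only [invs, Finset.mem_filter, Finset.mem_product, Finset.mem_Icc] at h
  omega

theorem invs_one : invs (1 : Equiv.Perm (Fin n)) = ∅ := by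
  ext ⟨a, b⟩
  rw [mem_invs]
  simp
  omega

/-- `s` is the simple transposition of the positions `m` and `m + 1`. -/
def IsAdj (s : Equiv.Perm (Fin n)) (m : ℕ) : Prop :=
  ∀ a, permVal s a = Equiv.swap m (m + 1) a

theorem IsAdj.mul_self {s : Equiv.Perm (Fin n)} {m : ℕ} (h : IsAdj s m) : s * s = 1 :=
  permVal_ext fun a => by rw [permVal_mul, h, h]; simp

theorem IsAdj.inv {s : Equiv.Perm (Fin n)} {m : ℕ} (h : IsAdj s m) : s⁻¹ = s :=
  inv_eq_of_mul_eq_one_left h.mul_self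

theorem permVal_mul_adj_inv {u s : Equiv.Perm (Fin n)} {m : ℕ} (h : IsAdj s m) (a : ℕ) :
    permVal (u * s)⁻¹ a = Equiv.swap m (m + 1) (permVal u⁻¹ a) := by
  rw [mul_inv_rev, permVal_mul, h.inv, h]

theorem swap_lt_swap_iff {m x y : ℕ} (h : ¬(x = m ∧ y = m + 1)) (h' : ¬(x = m + 1 ∧ y = m)) :
    Equiv.swap m (m + 1) x < Equiv.swap m (m + 1) y ↔ x < y := by
  simp only [Equiv.swap_apply_def]
  split_ifs <;> omega

theorem invs_mul_adj {u s : Equiv.Perm (Fin n)} {m : ℕ} (h : IsAdj s m)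
    (hm : permVal u m < permVal u (m + 1)) :
    invs (u * s) = insert (permVal u m, permVal u (m + 1)) (invs u) := by
  ext ⟨a, b⟩
  rw [Finset.mem_insert, mem_invs, mem_invs, permVal_mul_adj_inv h, permVal_mul_adj_inv h,
    Prod.mk.injEq]
  by_cases h1 : permVal u⁻¹ b = m ∧ permVal u⁻¹ a = m + 1
  · have hb : b = permVal u m := by rw [← h1.1]; simp
    have ha : a = permVal u (m + 1) := by rw [← h1.2]; simp
    subst ha hb
    omega
  by_cases h2 : permVal u⁻¹ b = m + 1 ∧ permVal u⁻¹ a = m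
  · have hb : b = permVal u (m + 1) := by rw [← h2.1]; simp
    have ha : a = permVal u m := by rw [← h2.2]; simp
    subst ha hb
    simp [hm]
  · rw [swap_lt_swap_iff h1 h2]
    constructor
    · exact Or.inr
    · rintro (⟨rfl, rfl⟩ | h3)
      · simp at h2
      · exact h3

theorem not_mem_invs_of_lt {u : Equiv.Perm (Fin n)} {m : ℕ} :
    (permVal u m, permVal u (m + 1)) ∉ invs u := by
  rw [mem_invs]; simp

theorem card_invs_mul_adj {u s : Equiv.Perm (Fin n)} {m : ℕ} (h : IsAdj s m)
    (hm : permVal u m < permVal u (m + 1)) : (invs (u * s)).card = (invs u).card + 1 := by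
  rw [invs_mul_adj h hm, Finset.card_insert_of_notMem not_mem_invs_of_lt]

theorem permVal_mul_adj_left {u s : Equiv.Perm (Fin n)} {m : ℕ} (h : IsAdj s m) :
    permVal (u * s) m = permVal u (m + 1) := by rw [permVal_mul, h]; simp

theorem permVal_mul_adj_right {u s : Equiv.Perm (Fin n)} {m : ℕ} (h : IsAdj s m) :
    permVal (u * s) (m + 1) = permVal u m := by rw [permVal_mul, h]; simp

theorem card_invs_mul_adj' {u s : Equiv.Perm (Fin n)} {m : ℕ} (h : IsAdj s m)
    (hm : permVal u (m + 1) < permVal u m) : (invs (u * s)).card + 1 = (invs u).card := by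
  rw [← card_invs_mul_adj h (u := u * s), mul_assoc, h.mul_self, mul_one]
  rwa [permVal_mul_adj_left h, permVal_mul_adj_right h]

theorem permVal_succ_lt_or_gt (u : Equiv.Perm (Fin n)) (m : ℕ) :
    permVal u m < permVal u (m + 1) ∨ permVal u (m + 1) < permVal u m := by
  have := (permVal_injective u).ne (show m ≠ m + 1 by omega)
  omega

/-- Extended by the identity, both `g` and its inverse are strictly increasing on `ℕ`, so each
dominates the identity. -/
theorem eq_one_of_lt_succ {g : Equiv.Perm (Fin n)}
    (h : ∀ m, 1 ≤ m → m < n → permVal g m < permVal g (m + 1)) : g = 1 := by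
  have hs : StrictMono (permVal g) := by
    refine strictMono_nat_of_lt_succ fun m => ?_
    rcases Nat.eq_zero_or_pos m with rfl | h1
    · rw [permVal_zero]; exact permVal_pos g (by omega)
    · by_cases h2 : m < n
      · exact h m h1 h2
      · rw [permVal_gt g (by omega : n < m + 1)]
        by_cases h3 : m ≤ n
        · have := permVal_le g h3; omega
        · rw [permVal_gt g (by omega : n < m)]; omega
  refine permVal_ext fun a => ?_
  rw [permVal_one]
  refine le_antisymm ?_ hs.le_apply
  have hs' : StrictMono (permVal g⁻¹) := by
    intro x y hxy
    rw [← hs.lt_iff_lt]; simpa using hxy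
  simpa using hs'.le_apply (x := permVal g a)

/-! ### Length counts inversions, and weak order is inclusion of inversion sets -/

theorem card_invs_le_length (l : List (Equiv.Perm (Fin n)))
    (hl : ∀ s ∈ l, IsSimpleTransposition s) : (invs l.prod).card ≤ l.length := by
  induction l using List.reverseRecOn with
  | nil => simp [invs_one]
  | append_singleton l s ih =>
    have ih := ih fun t ht => hl t (by simp [ht])
    obtain ⟨m, -, -, hs⟩ := isSimpleTransposition_iff.1 (hl s (by simp))
    rw [List.prod_append, List.prod_singleton, List.length_append, List.length_singleton]
    rcases permVal_succ_lt_or_gt l.prod m with h | h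
    · rw [card_invs_mul_adj hs h]; omega
    · have := card_invs_mul_adj' hs h; omega

theorem exists_word (w : Equiv.Perm (Fin n)) : ∃ l : List (Equiv.Perm (Fin n)),
    (∀ s ∈ l, IsSimpleTransposition s) ∧ l.prod = w ∧ l.length = (invs w).card := by
  generalize hc : (invs w).card = c
  induction c generalizing w with
  | zero =>
    refine ⟨[], by simp, ?_, rfl⟩
    by_contra hne
    apply hne
    rw [List.prod_nil, eq_comm]
    refine eq_one_of_lt_succ fun m h1 h2 => ?_
    rcases permVal_succ_lt_or_gt w m with h | h
    · exact h
    · obtain ⟨s, -, hs⟩ := exists_simpleTransposition h1 h2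
      have := card_invs_mul_adj' hs h; omega
  | succ c ih =>
    have : ∃ m, 1 ≤ m ∧ m < n ∧ permVal w (m + 1) < permVal w m := by
      by_contra! hcon
      have : w = 1 := eq_one_of_lt_succ fun m h1 h2 =>
        lt_of_le_of_ne (hcon m h1 h2) ((permVal_injective w).ne (by omega))
      subst this
      simp [invs_one] at hc
    obtain ⟨m, h1, h2, hm⟩ := this
    obtain ⟨s, hs1, hs⟩ := exists_simpleTransposition h1 h2
    have h3 := card_invs_mul_adj' hs hm
    obtain ⟨l, hl1, hl2, hl3⟩ := ih (w * s) (by omega)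
    refine ⟨l ++ [s], ?_, ?_, by simp [hl3]⟩
    · intro t ht
      rcases List.mem_append.1 ht with h | h
      · exact hl1 t h
      · rw [List.mem_singleton.1 h]; exact hs1
    · rw [List.prod_append, hl2, List.prod_singleton, mul_assoc, IsAdj.mul_self hs, mul_one]

theorem permLength_eq_card_invs (w : Equiv.Perm (Fin n)) : permLength w = (invs w).card := by
  refine le_antisymm (Nat.sInf_le (exists_word w)) ?_
  obtain ⟨l, h1, h2, h3⟩ := Nat.sInf_mem (⟨_, exists_word w⟩ :
    {m : ℕ | ∃ l : List (Equiv.Perm (Fin n)),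
      (∀ s ∈ l, IsSimpleTransposition s) ∧ l.prod = w ∧ l.length = m}.Nonempty)
  rw [permLength, ← h3, ← h2]
  exact card_invs_le_length l h1

theorem weakStep_iff {u v : Equiv.Perm (Fin n)} :
    WeakStep u v ↔ ∃ m s, 1 ≤ m ∧ m < n ∧ IsAdj s m ∧ v = u * s ∧
      permVal u m < permVal u (m + 1) := by
  constructor
  · rintro ⟨s, hs, rfl, hl⟩
    obtain ⟨m, h1, h2, hs⟩ := isSimpleTransposition_iff.1 hs
    refine ⟨m, s, h1, h2, hs, rfl, ?_⟩
    rcases permVal_succ_lt_or_gt u m with h | h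
    · exact h
    · have := card_invs_mul_adj' hs h
      rw [permLength_eq_card_invs, permLength_eq_card_invs] at hl
      omega
  · rintro ⟨m, s, h1, h2, hs, rfl, h⟩
    refine ⟨s, isSimpleTransposition_iff.2 ⟨m, h1, h2, hs⟩, rfl, ?_⟩
    rw [permLength_eq_card_invs, permLength_eq_card_invs, card_invs_mul_adj hs h]

theorem invs_subset_of_le {u w : Equiv.Perm (Fin n)} (h : u ≤ w) : invs u ⊆ invs w := by
  change Relation.ReflTransGen WeakStep u w at h
  induction h with
  | refl => exact subset_rfl
  | tail _ h ih =>
    obtain ⟨m, s, -, -, hs, rfl, hm⟩ := weakStep_iff.1 h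
    rw [invs_mul_adj hs hm]
    exact ih.trans (Finset.subset_insert _ _)

/-- As `w⁻¹ * u` is not the identity it has a descent `m`: the letters of `u` at `m` and `m + 1`
occur in the opposite order in `w`. They form an ascent of `u`, as otherwise their inversion would
be shared by `w`. Exchanging them therefore adds an inversion of `w`. -/
theorem exists_weakStep_of_invs_subset {u w : Equiv.Perm (Fin n)} (h : invs u ⊆ invs w)
    (hne : u ≠ w) : ∃ v, WeakStep u v ∧ invs v ⊆ invs w := by
  have : ∃ m, 1 ≤ m ∧ m < n ∧ ¬ permVal (w⁻¹ * u) m < permVal (w⁻¹ * u) (m + 1) := by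
    by_contra! hcon
    exact hne (inv_mul_eq_one.1 (eq_one_of_lt_succ hcon)).symm
  obtain ⟨m, h1, h2, hm⟩ := this
  have hm' := (permVal_succ_lt_or_gt (w⁻¹ * u) m).resolve_left hm
  rw [permVal_mul, permVal_mul] at hm'
  have hu : permVal u m < permVal u (m + 1) := by
    refine (permVal_succ_lt_or_gt u m).resolve_right fun hgt => ?_
    have := mem_invs.1 (h (mem_invs.2 ⟨hgt, by simp⟩))
    omega
  obtain ⟨s, -, hs⟩ := exists_simpleTransposition h1 h2
  refine ⟨u * s, weakStep_iff.2 ⟨m, s, h1, h2, hs, rfl, hu⟩, ?_⟩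
  rw [invs_mul_adj hs hu]
  exact Finset.insert_subset (mem_invs.2 ⟨hu, hm'⟩) h

theorem card_invs_of_weakStep {u v : Equiv.Perm (Fin n)} (h : WeakStep u v) :
    (invs v).card = (invs u).card + 1 := by
  obtain ⟨m, s, -, -, hs, rfl, hm⟩ := weakStep_iff.1 h
  exact card_invs_mul_adj hs hm

theorem weak_le_iff {u w : Equiv.Perm (Fin n)} : u ≤ w ↔ invs u ⊆ invs w := by
  refine ⟨invs_subset_of_le, fun h => ?_⟩
  generalize hc : (invs w).card - (invs u).card = c
  induction c generalizing u with
  | zero =>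
    by_contra hle
    have hne : u ≠ w := fun h => hle h.le
    obtain ⟨v, hv, hvw⟩ := exists_weakStep_of_invs_subset h hne
    have := card_invs_of_weakStep hv
    have := Finset.card_le_card hvw
    omega
  | succ c ih =>
    have hne : u ≠ w := by rintro rfl; omega
    obtain ⟨v, hv, hvw⟩ := exists_weakStep_of_invs_subset h hne
    have := card_invs_of_weakStep hv
    have := Finset.card_le_card hvw
    exact le_trans (Relation.ReflTransGen.single hv) (ih hvw (by omega))

theorem invs_injective : Function.Injective (invs : Equiv.Perm (Fin n) → Finset (ℕ × ℕ)) :=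
  fun _ _ h => le_antisymm (weak_le_iff.2 h.subset) (weak_le_iff.2 h.superset)

theorem weak_covBy_iff {u v : Equiv.Perm (Fin n)} : u ⋖ v ↔ WeakStep u v := by
  constructor
  · intro h
    obtain ⟨x, hx, hxv⟩ := exists_weakStep_of_invs_subset (weak_le_iff.1 h.le) h.lt.ne
    have hux : u < x := by
      refine lt_of_le_of_ne (Relation.ReflTransGen.single hx) ?_
      rintro rfl
      have := card_invs_of_weakStep hx
      omega
    rcases (weak_le_iff.2 hxv).eq_or_lt with rfl | hlt
    · exact hx
    · exact absurd hlt (h.2 hux)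
  · intro h
    have hc := card_invs_of_weakStep h
    have key : ∀ {x y : Equiv.Perm (Fin n)}, x < y → (invs x).card < (invs y).card := by
      intro x y hxy
      refine Finset.card_lt_card (lt_of_le_of_ne (weak_le_iff.1 hxy.le) ?_)
      exact fun h => hxy.ne (invs_injective h)
    refine ⟨lt_of_le_of_ne (Relation.ReflTransGen.single h) ?_, fun x h1 h2 => ?_⟩
    · rintro rfl; omega
    · have := key h1; have := key h2; omega

end Inversions

/-! ### Arcs -/

section Arcs

variable {n : ℕ}

/-- An arc `(a, b, S)` between the values `a < b`; `S` is the set of values strictly between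
`a` and `b` that lie to the left of the arc. -/
abbrev Arc := ℕ × ℕ × Finset ℕ

/-- The arc joining the values of `w` at the positions `m` and `m + 1`. -/
def arcAt (w : Equiv.Perm (Fin n)) (m : ℕ) : Arc :=
  (min (permVal w m) (permVal w (m + 1)), max (permVal w m) (permVal w (m + 1)),
    (Finset.Ioo (min (permVal w m) (permVal w (m + 1))) (max (permVal w m) (permVal w (m + 1)))).filter
      fun c => permVal w⁻¹ c < m)

/-- The arcs of the descents of `w`. -/
def darcs (w : Equiv.Perm (Fin n)) : Finset Arc :=
  ((Finset.Ico 1 n).filter fun m => permVal w (m + 1) < permVal w m).image (arcAt w)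

/-- The arcs of the ascents of `w`. -/
def uarcs (w : Equiv.Perm (Fin n)) : Finset Arc :=
  ((Finset.Ico 1 n).filter fun m => permVal w m < permVal w (m + 1)).image (arcAt w)

theorem mem_darcs {w : Equiv.Perm (Fin n)} {a b : ℕ} {S : Finset ℕ} :
    (a, b, S) ∈ darcs w ↔ a < b ∧ permVal w⁻¹ a = permVal w⁻¹ b + 1 ∧
      S = (Finset.Ioo a b).filter fun c => permVal w⁻¹ c < permVal w⁻¹ b := by
  simp only [darcs, Finset.mem_image, Finset.mem_filter, Finset.mem_Ico, arcAt, Prod.mk.injEq]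
  constructor
  · rintro ⟨m, ⟨hm, hlt⟩, h1, h2, h3⟩
    rw [min_eq_right hlt.le] at h1 h3
    rw [max_eq_left hlt.le] at h2 h3
    subst h1 h2
    simp only [permVal_inv_apply]
    exact ⟨hlt, trivial, h3.symm⟩
  · rintro ⟨hab, h1, rfl⟩
    have ha : permVal w (permVal w⁻¹ b + 1) = a := by rw [← h1]; simp
    have hi := mem_invs.2 ⟨hab, (by omega : permVal w⁻¹ b < permVal w⁻¹ a)⟩
    have hi := bounds_of_mem_invs hi
    have := permVal_le w⁻¹ (by omega : a ≤ n)
    have := permVal_pos w⁻¹ (by omega : 1 ≤ b)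
    refine ⟨permVal w⁻¹ b, ⟨⟨this, by omega⟩, ?_⟩, ?_, ?_, ?_⟩
    · rw [ha]; simpa using hab
    all_goals rw [ha, permVal_apply_inv]
    · exact min_eq_right hab.le
    · exact max_eq_left hab.le
    · rw [min_eq_right hab.le, max_eq_left hab.le]

/-- The bounds on `a` and `b` are needed because `permVal` is the identity outside `1, …, n`: the
pair of `0` and the first letter would otherwise qualify. For descents the bounds follow from having
an inversion. -/
theorem mem_uarcs {w : Equiv.Perm (Fin n)} {a b : ℕ} {S : Finset ℕ} :
    (a, b, S) ∈ uarcs w ↔ a < b ∧ 1 ≤ a ∧ b ≤ n ∧ permVal w⁻¹ b = permVal w⁻¹ a + 1 ∧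
      S = (Finset.Ioo a b).filter fun c => permVal w⁻¹ c < permVal w⁻¹ a := by
  simp only [uarcs, Finset.mem_image, Finset.mem_filter, Finset.mem_Ico, arcAt, Prod.mk.injEq]
  constructor
  · rintro ⟨m, ⟨hm, hlt⟩, h1, h2, h3⟩
    rw [min_eq_left hlt.le] at h1 h3
    rw [max_eq_right hlt.le] at h2 h3
    subst h1 h2
    simp only [permVal_inv_apply]
    exact ⟨hlt, permVal_pos w hm.1, permVal_le w (by omega), trivial, h3.symm⟩
  · rintro ⟨hab, h0, hn, h1, rfl⟩
    have hb : permVal w (permVal w⁻¹ a + 1) = b := by rw [← h1]; simp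
    have := permVal_le w⁻¹ hn
    have := permVal_pos w⁻¹ h0
    refine ⟨permVal w⁻¹ a, ⟨⟨this, by omega⟩, ?_⟩, ?_, ?_, ?_⟩
    · rw [hb]; simpa using hab
    all_goals rw [hb, permVal_apply_inv]
    · exact min_eq_left hab.le
    · exact max_eq_right hab.le
    · rw [min_eq_left hab.le, max_eq_right hab.le]

/-- `(a, b, S)` is an arc on the values `1, …, n`. -/
def IsArc (n : ℕ) (t : Arc) : Prop :=
  1 ≤ t.1 ∧ t.1 < t.2.1 ∧ t.2.1 ≤ n ∧ t.2.2 ⊆ Finset.Ioo t.1 t.2.1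

/-- The inversions of the join-irreducible permutation of an arc. -/
def ArcInv (t : Arc) (c d : ℕ) : Prop :=
  t.1 ≤ c ∧ c < d ∧ d ≤ t.2.1 ∧ (d = t.2.1 ∨ d ∈ t.2.2) ∧ c ∉ t.2.2

theorem isArc_of_mem_darcs {w : Equiv.Perm (Fin n)} {t : Arc} (h : t ∈ darcs w) : IsArc n t := by
  obtain ⟨a, b, S⟩ := t
  obtain ⟨h1, h2, rfl⟩ := mem_darcs.1 h
  have hi := mem_invs.2 ⟨h1, (by omega : permVal w⁻¹ b < permVal w⁻¹ a)⟩
  have hi := bounds_of_mem_invs hi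
  exact ⟨hi.1, h1, hi.2.2, Finset.filter_subset _ _⟩

theorem isArc_of_mem_uarcs {w : Equiv.Perm (Fin n)} {t : Arc} (h : t ∈ uarcs w) : IsArc n t := by
  obtain ⟨a, b, S⟩ := t
  obtain ⟨h1, h2, h3, -, rfl⟩ := mem_uarcs.1 h
  exact ⟨h2, h1, h3, Finset.filter_subset _ _⟩

/-- The widest inversion gives the endpoints `a, b`, and the inversions `(a, d)` with `d < b` give
the set `S`. -/
theorem IsArc.eq_of_arcInv_iff {t t' : Arc} (h : IsArc n t) (h' : IsArc n t')
    (H : ∀ c d, ArcInv t c d ↔ ArcInv t' c d) : t = t' := by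
  obtain ⟨a, b, S⟩ := t
  obtain ⟨a', b', S'⟩ := t'
  obtain ⟨h1, h2, h3, h4⟩ := h
  obtain ⟨h1', h2', h3', h4'⟩ := h'
  simp only [ArcInv] at *
  have ha : a ∉ S := fun h => by simpa using h4 h
  have ha' : a' ∉ S' := fun h => by simpa using h4' h
  have e1 := (H a b).1 ⟨le_rfl, h2, le_rfl, Or.inl rfl, ha⟩
  have e2 := (H a' b').2 ⟨le_rfl, h2', le_rfl, Or.inl rfl, ha'⟩
  obtain rfl : a = a' := by omega
  obtain rfl : b = b' := by omega
  congr 2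
  ext d
  by_cases hd : d ∈ Finset.Ioo a b
  · have hd' := Finset.mem_Ioo.1 hd
    have := H a d
    simp only [le_refl, hd'.1, hd'.2.le, hd'.2.ne, ha, ha', true_and, false_or, not_false_eq_true,
      and_true] at this
    exact this
  · exact iff_of_false (fun h => hd (h4 h)) (fun h => hd (h4' h))

/-! ### One-line words and the permutation of an arc -/

theorem mem_oneLine {w : Equiv.Perm (Fin n)} {a : ℕ} : a ∈ oneLine w ↔ 1 ≤ a ∧ a ≤ n := by
  rw [oneLine, List.mem_ofFn]
  constructor
  · rintro ⟨i, rfl⟩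
    have := (w i).isLt
    omega
  · intro h
    refine ⟨w⁻¹ ⟨a - 1, by omega⟩, ?_⟩
    simp; omega

theorem oneLine_injective : Function.Injective (oneLine : Equiv.Perm (Fin n) → List ℕ) := by
  intro u v h
  have := List.ofFn_injective h
  ext i
  have := congrFun this i
  simpa using this

theorem pairwise_oneLine_iff {w : Equiv.Perm (Fin n)} {R : ℕ → ℕ → Prop} :
    (oneLine w).Pairwise R ↔ ∀ c d, 1 ≤ c → c ≤ n → 1 ≤ d → d ≤ n →
      permVal w⁻¹ c < permVal w⁻¹ d → R c d := by
  rw [oneLine, List.pairwise_ofFn]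
  constructor
  · intro h c d hc hc' hd hd' hlt
    rw [permVal_of_mem _ ⟨hc, hc'⟩, permVal_of_mem _ ⟨hd, hd'⟩] at hlt
    have := h (i := w⁻¹ ⟨c - 1, by omega⟩) (j := w⁻¹ ⟨d - 1, by omega⟩) (by
      rw [Fin.lt_def]; omega)
    simpa [Nat.sub_add_cancel hc, Nat.sub_add_cancel hd] using this
  · intro h i j hij
    have hi := (w i).isLt
    have hj := (w j).isLt
    refine h _ _ (by omega) (by omega) (by omega) (by omega) ?_
    rw [← permVal_fin, ← permVal_fin]
    simpa using hij

theorem exists_oneLine_eq {l : List ℕ} (h1 : l.Nodup) (h2 : ∀ x, x ∈ l ↔ 1 ≤ x ∧ x ≤ n) :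
    ∃ w : Equiv.Perm (Fin n), oneLine w = l := by
  have hlen : l.length = n := by
    rw [← List.toFinset_card_of_nodup h1, show l.toFinset = Finset.Icc 1 n by ext; simp [h2]]
    simp
  have hb : ∀ i : Fin n, 1 ≤ l[(i : ℕ)]'(by omega) ∧ l[(i : ℕ)]'(by omega) ≤ n := fun i =>
    (h2 _).1 (List.getElem_mem _)
  let f : Fin n → Fin n := fun i => ⟨l[(i : ℕ)]'(by omega) - 1, by have := hb i; omega⟩
  have hf : Function.Injective f := by
    intro i j hij
    have h3 := hb i
    have h4 := hb j
    have h5 : l[(i : ℕ)]'(by omega) = l[(j : ℕ)]'(by omega) := by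
      have := congrArg Fin.val hij
      simp only [f] at this
      omega
    exact Fin.ext ((h1.getElem_inj_iff).1 h5)
  refine ⟨Equiv.ofBijective f (Finite.injective_iff_bijective.1 hf), ?_⟩
  refine List.ext_getElem (by simp [oneLine, hlen]) fun i hi hi' => ?_
  have := hb ⟨i, by omega⟩
  simp only [oneLine, List.getElem_ofFn, Equiv.ofBijective_apply, f]
  exact Nat.sub_add_cancel this.1

/-- The order of two letters in a word with inversions `ArcInv t`. -/
def ArcOrd (t : Arc) (x y : ℕ) : Prop :=
  (x < y ∧ ¬ArcInv t x y) ∨ (y < x ∧ ArcInv t y x)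

theorem pairwise_grassWord {t : Arc} (ht : IsArc n t) :
    (grassWord n t.1 t.2.1 t.2.2).Pairwise (ArcOrd t) := by
  obtain ⟨a, b, S⟩ := t
  obtain ⟨h1, h2, h3, h4⟩ := ht
  simp only at h1 h2 h3 h4
  have hS : ∀ x ∈ S, a < x ∧ x < b := fun x hx => Finset.mem_Ioo.1 (h4 hx)
  have ha : a ∉ S := fun h => by have := hS a h; omega
  have hb : b ∉ S := fun h => by have := hS b h; omega
  simp only [grassWord, List.pairwise_append, List.mem_append, List.mem_range'_1,
    Finset.mem_sort, Finset.mem_sdiff, Finset.mem_Ioo, List.mem_cons, List.not_mem_nil, or_false,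
    List.pairwise_cons, List.Pairwise.nil, and_true, forall_eq, false_implies, implies_true,
    ArcOrd, ArcInv]
  refine ⟨⟨⟨⟨?_, ?_, ?_⟩, ?_, ?_⟩, ?_, ?_⟩, ?_, ?_⟩
  · refine List.Pairwise.imp_of_mem ?_ (List.pairwise_lt_range' (s := 1) (n := a - 1) (step := 1))
    intro x y hx hy hxy
    simp only [ArcOrd, ArcInv]
    simp only [List.mem_range'_1] at hx hy
    left; omega
  · refine List.Pairwise.imp_of_mem ?_ (Finset.sortedLT_sort S).pairwise
    intro x y hx hy hxy
    simp only [ArcOrd, ArcInv]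
    rw [Finset.mem_sort] at hx hy
    exact Or.inl ⟨hxy, by tauto⟩
  · intro x hx y hy
    have := hS y hy
    left; omega
  · right
    simp [h2, ha]
  · rintro x (hx | hx) y (rfl | rfl)
    · left; omega
    · left; omega
    · have := hS x hx
      exact Or.inl ⟨this.2, by tauto⟩
    · have := hS x hx
      exact Or.inr ⟨this.1, le_rfl, this.1, this.2.le, Or.inr hx, ha⟩
  · refine List.Pairwise.imp_of_mem ?_ (Finset.sortedLT_sort (Finset.Ioo a b \ S)).pairwise
    intro x y hx hy hxy
    simp only [ArcOrd, ArcInv]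
    simp only [Finset.mem_sort, Finset.mem_sdiff, Finset.mem_Ioo] at hx hy
    refine Or.inl ⟨hxy, ?_⟩
    rintro ⟨-, -, -, h | h, -⟩
    · omega
    · exact hy.2 h
  · rintro x ((hx | hx) | (rfl | rfl)) y ⟨⟨hy1, hy2⟩, hyS⟩
    · left; omega
    · have := hS x hx
      rcases lt_trichotomy x y with h | rfl | h
      · exact Or.inl ⟨h, by tauto⟩
      · exact absurd hx hyS
      · exact Or.inr ⟨h, hy1.le, h, this.2.le, Or.inr hx, hyS⟩
    · exact Or.inr ⟨hy2, hy1.le, hy2, le_rfl, Or.inl rfl, hyS⟩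
    · refine Or.inl ⟨hy1, ?_⟩
      rintro ⟨-, -, -, h | h, -⟩
      · exact hy2.ne h
      · exact hyS h
  · refine List.Pairwise.imp_of_mem ?_
      (List.pairwise_lt_range' (s := b + 1) (n := n - b) (step := 1))
    intro x y hx hy hxy
    simp only [ArcOrd, ArcInv]
    simp only [List.mem_range'_1] at hx hy
    left; omega
  · rintro x (((hx | hx) | (rfl | rfl)) | hx) y hy
    · left; omega
    · have := hS x hx
      left; omega
    · left; omega
    · left; omega
    · left; omega

theorem exists_perm_of_isArc {t : Arc} (ht : IsArc n t) : ∃ p : Equiv.Perm (Fin n),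
    oneLine p = grassWord n t.1 t.2.1 t.2.2 ∧ ∀ c d, (c, d) ∈ invs p ↔ ArcInv t c d := by
  have hp := pairwise_grassWord ht
  have hnd : (grassWord n t.1 t.2.1 t.2.2).Nodup := hp.imp fun {x y} h => by
    rintro rfl
    rcases h with h | h <;> exact lt_irrefl _ h.1
  obtain ⟨p, h⟩ := exists_oneLine_eq (n := n) hnd (by
    intro x
    obtain ⟨a, b, S⟩ := t
    obtain ⟨h1, h2, h3, h4⟩ := ht
    simp only at h1 h2 h3 h4
    have hS : x ∈ S → a < x ∧ x < b := fun hx => Finset.mem_Ioo.1 (h4 hx)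
    simp only [grassWord, List.mem_append, List.mem_range'_1,
      Finset.mem_sort, Finset.mem_sdiff, Finset.mem_Ioo, List.mem_cons, List.not_mem_nil, or_false]
    by_cases hx : x ∈ S
    · have := hS hx
      simp only [hx, true_or, or_true, true_iff, not_true_eq_false, and_false]; omega
    · simp only [hx, or_false, not_false_eq_true, and_true]; omega)
  refine ⟨p, h, fun c d => ?_⟩
  rw [← h, pairwise_oneLine_iff] at hp
  rw [mem_invs]
  constructor
  · rintro ⟨hcd, hlt⟩
    have hi := mem_invs.2 ⟨hcd, hlt⟩
    have hi := bounds_of_mem_invs hi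
    rcases hp d c (by omega) (by omega) (by omega) (by omega) hlt with h | h
    · omega
    · exact h.2
  · intro hi
    obtain ⟨h1, h2, h3, -⟩ := id hi
    have := ht.1
    have := ht.2.2.1
    refine ⟨h2, lt_of_le_of_ne (not_lt.1 fun hlt => ?_) ((permVal_injective _).ne h2.ne')⟩
    rcases hp c d (by omega) (by omega) (by omega) (by omega) hlt with h | h
    · exact h.2 hi
    · omega

theorem mem_invs_of_oneLine_eq {t : Arc} (ht : IsArc n t) {p : Equiv.Perm (Fin n)}
    (hp : oneLine p = grassWord n t.1 t.2.1 t.2.2) {c d : ℕ} : (c, d) ∈ invs p ↔ ArcInv t c d := by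
  obtain ⟨q, hq, h⟩ := exists_perm_of_isArc ht
  rw [oneLine_injective (hp.trans hq.symm)]
  exact h c d

end Arcs

/-! ### Edge labels of the weak order -/

section Labels

variable {n : ℕ}

theorem arcAt_mem_uarcs {w : Equiv.Perm (Fin n)} {m : ℕ} (h1 : 1 ≤ m) (h2 : m < n)
    (h : permVal w m < permVal w (m + 1)) : arcAt w m ∈ uarcs w :=
  Finset.mem_image_of_mem _ (by simp [h1, h2, h])

theorem arcAt_mem_darcs {w : Equiv.Perm (Fin n)} {m : ℕ} (h1 : 1 ≤ m) (h2 : m < n)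
    (h : permVal w (m + 1) < permVal w m) : arcAt w m ∈ darcs w :=
  Finset.mem_image_of_mem _ (by simp [h1, h2, h])

/-- The exchanged letters are the endpoints of the arc, and no letter strictly between them in value
moves. -/
theorem arcAt_mul_adj {x s : Equiv.Perm (Fin n)} {m : ℕ} (hs : IsAdj s m) :
    arcAt (x * s) m = arcAt x m := by
  simp only [arcAt, permVal_mul_adj_left hs, permVal_mul_adj_right hs, permVal_mul_adj_inv hs]
  rw [min_comm, max_comm]
  congr 2
  refine Finset.filter_congr fun c hc => ?_
  have h1 : permVal x⁻¹ c ≠ m := by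
    rintro rfl
    rw [Finset.mem_Ioo] at hc
    simp only [permVal_apply_inv] at hc
    omega
  have h2 : permVal x⁻¹ c ≠ m + 1 := by
    intro h
    rw [← h, Finset.mem_Ioo] at hc
    simp only [permVal_apply_inv] at hc
    omega
  rw [Equiv.swap_apply_of_ne_of_ne h1 h2]

theorem mem_invs_of_not_le {x s z : Equiv.Perm (Fin n)} {m : ℕ} (hs : IsAdj s m)
    (hm : permVal x m < permVal x (m + 1)) (hz : z ≤ x * s) (hzx : ¬z ≤ x) :
    (permVal x m, permVal x (m + 1)) ∈ invs z := by
  rw [weak_le_iff, invs_mul_adj hs hm] at hz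
  rw [weak_le_iff] at hzx
  by_contra hcon
  exact hzx ((Finset.subset_insert_iff_of_notMem hcon).1 hz)

/-- Let `a < b` be the exchanged letters. An element `z` with join `x * s` lies below `x * s` but
not below `x`, so it has `b` before `a`. For an inversion `(c, d)` of the arc, `x * s` has `d`
weakly before `b` and `a` weakly before `c`, neither pair being inverted; `z` inherits this. Hence
`d` precedes `c` in `z`, and `p ≤ z`. -/
theorem isLeast_label {x s p : Equiv.Perm (Fin n)} {m : ℕ} (hs : IsAdj s m)
    (hm : permVal x m < permVal x (m + 1))
    (hp : ∀ c d, (c, d) ∈ invs p ↔ ArcInv (arcAt x m) c d) :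
    IsLeast {z | IsLUB {x, z} (x * s)} p := by
  have hxy : x ≤ x * s := by
    rw [weak_le_iff, invs_mul_adj hs hm]; exact Finset.subset_insert _ _
  have harc : ∀ c d, ArcInv (arcAt x m) c d → c < d ∧
      (d = permVal x (m + 1) ∨ d < permVal x (m + 1) ∧ permVal x⁻¹ d < m) ∧
      (c = permVal x m ∨ permVal x m < c ∧ m + 1 < permVal x⁻¹ c) := by
    intro c d h
    simp only [ArcInv, arcAt, min_eq_left hm.le, max_eq_right hm.le, Finset.mem_filter,
      Finset.mem_Ioo] at h
    obtain ⟨h1, h2, h3, h4, h5⟩ := h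
    refine ⟨h2, ?_, ?_⟩
    · rcases h4 with h4 | h4
      · exact Or.inl h4
      · exact Or.inr ⟨h4.1.2, h4.2⟩
    · rcases h1.eq_or_lt with h1 | h1
      · exact Or.inl h1.symm
      · refine Or.inr ⟨h1, ?_⟩
        have h6 : m ≤ permVal x⁻¹ c := not_lt.1 fun h => h5 ⟨⟨h1, by omega⟩, h⟩
        have h7 : permVal x⁻¹ c ≠ m := by
          intro h; rw [← h] at h1; simp at h1
        have h8 : permVal x⁻¹ c ≠ m + 1 := by
          intro h; rw [← h] at h3; simp at h3; omega
        omega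
  have hpy : p ≤ x * s := by
    rw [weak_le_iff]
    rintro ⟨c, d⟩ h
    rw [hp] at h
    obtain ⟨h1, h2, h3⟩ := harc c d h
    rw [mem_invs, permVal_mul_adj_inv hs, permVal_mul_adj_inv hs]
    refine ⟨h1, ?_⟩
    have e1 : Equiv.swap m (m + 1) (permVal x⁻¹ d) ≤ m := by
      rcases h2 with rfl | ⟨-, h2⟩
      · simp
      · rw [Equiv.swap_apply_of_ne_of_ne] <;> omega
    have e2 : m + 1 ≤ Equiv.swap m (m + 1) (permVal x⁻¹ c) := by
      rcases h3 with rfl | ⟨-, h3⟩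
      · simp
      · rw [Equiv.swap_apply_of_ne_of_ne] <;> omega
    omega
  have hpm : (permVal x m, permVal x (m + 1)) ∈ invs p := by
    rw [hp]
    simp [ArcInv, arcAt, min_eq_left hm.le, max_eq_right hm.le, hm]
  constructor
  · constructor
    · rintro z (rfl | rfl)
      · exact hxy
      · exact hpy
    · intro w hw
      have h1 := weak_le_iff.1 (hw (Set.mem_insert _ _))
      have h2 := weak_le_iff.1 (hw (Set.mem_insert_of_mem _ rfl))
      rw [weak_le_iff, invs_mul_adj hs hm]
      exact Finset.insert_subset (h2 hpm) h1
  · intro z hz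
    have hzy : z ≤ x * s := hz.1 (Set.mem_insert_of_mem _ rfl)
    have hzx : ¬z ≤ x := by
      intro h
      have h1 : x * s ≤ x := hz.2 (by
        rintro w (rfl | rfl)
        · exact le_rfl
        · exact h)
      have h2 := Finset.card_le_card (weak_le_iff.1 h1)
      rw [card_invs_mul_adj hs hm] at h2
      omega
    have hab := (mem_invs.1 (mem_invs_of_not_le hs hm hzy hzx)).2
    rw [weak_le_iff] at hzy ⊢
    rintro ⟨c, d⟩ h
    rw [hp] at h
    obtain ⟨h1, h2, h3⟩ := harc c d h
    rw [mem_invs]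
    refine ⟨h1, ?_⟩
    have e1 : permVal z⁻¹ d ≤ permVal z⁻¹ (permVal x (m + 1)) := by
      rcases h2 with rfl | ⟨h4, h5⟩
      · exact le_rfl
      · refine not_lt.1 fun hlt => ?_
        have := (mem_invs.1 (hzy (mem_invs.2 ⟨h4, hlt⟩))).2
        rw [permVal_mul_adj_inv hs, permVal_mul_adj_inv hs, permVal_inv_apply,
          Equiv.swap_apply_right, Equiv.swap_apply_of_ne_of_ne] at this <;> omega
    have e2 : permVal z⁻¹ (permVal x m) ≤ permVal z⁻¹ c := by
      rcases h3 with rfl | ⟨h4, h5⟩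
      · exact le_rfl
      · refine not_lt.1 fun hlt => ?_
        have := (mem_invs.1 (hzy (mem_invs.2 ⟨h4, hlt⟩))).2
        rw [permVal_mul_adj_inv hs, permVal_mul_adj_inv hs, permVal_inv_apply,
          Equiv.swap_apply_left, Equiv.swap_apply_of_ne_of_ne] at this <;> omega
    omega

/-- `p` is the join-irreducible permutation of the arc `t`. -/
def IsPermOfArc (t : Arc) (p : Equiv.Perm (Fin n)) : Prop :=
  oneLine p = grassWord n t.1 t.2.1 t.2.2

theorem IsArc.isPermOfArc_inj {t t' : Arc} (ht : IsArc n t) (ht' : IsArc n t')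
    {p : Equiv.Perm (Fin n)} (h : IsPermOfArc t p) (h' : IsPermOfArc t' p) : t = t' :=
  ht.eq_of_arcInv_iff ht' fun _ _ =>
    (mem_invs_of_oneLine_eq ht h).symm.trans (mem_invs_of_oneLine_eq ht' h')

theorem isEdgeLabel_mul_adj {x s p : Equiv.Perm (Fin n)} {m : ℕ} (h1 : 1 ≤ m) (h2 : m < n)
    (hs : IsAdj s m) (hm : permVal x m < permVal x (m + 1)) :
    IsEdgeLabel x (x * s) p ↔ IsPermOfArc (arcAt x m) p := by
  have harc := isArc_of_mem_uarcs (arcAt_mem_uarcs h1 h2 hm)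
  constructor
  · rintro ⟨-, hp⟩
    obtain ⟨q, hq, hq'⟩ := exists_perm_of_isArc harc
    rw [hp.unique (isLeast_label hs hm hq')]
    exact hq
  · intro hp
    exact ⟨weak_covBy_iff.2 (weakStep_iff.2 ⟨m, s, h1, h2, hs, rfl, hm⟩),
      isLeast_label hs hm fun _ _ => mem_invs_of_oneLine_eq harc hp⟩

theorem mem_downLabels {y p : Equiv.Perm (Fin n)} :
    p ∈ downLabels y ↔ ∃ t ∈ darcs y, IsPermOfArc t p := by
  constructor
  · rintro ⟨x, hx⟩
    obtain ⟨m, s, h1, h2, hs, rfl, hm⟩ := weakStep_iff.1 (weak_covBy_iff.1 hx.1)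
    refine ⟨arcAt (x * s) m, arcAt_mem_darcs h1 h2 ?_, ?_⟩
    · rwa [permVal_mul_adj_left hs, permVal_mul_adj_right hs]
    · rw [arcAt_mul_adj hs]
      exact (isEdgeLabel_mul_adj h1 h2 hs hm).1 hx
  · rintro ⟨t, ht, hp⟩
    obtain ⟨m, hm, rfl⟩ := Finset.mem_image.1 ht
    simp only [Finset.mem_filter, Finset.mem_Ico] at hm
    obtain ⟨⟨h1, h2⟩, hm⟩ := hm
    obtain ⟨s, -, hs⟩ := exists_simpleTransposition h1 h2
    have hm' : permVal (y * s) m < permVal (y * s) (m + 1) := by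
      rwa [permVal_mul_adj_left hs, permVal_mul_adj_right hs]
    refine ⟨y * s, ?_⟩
    have := isEdgeLabel_mul_adj (p := p) h1 h2 hs hm'
    rw [mul_assoc, IsAdj.mul_self hs, mul_one, arcAt_mul_adj hs] at this
    exact this.2 hp

theorem mem_upLabels {y p : Equiv.Perm (Fin n)} :
    p ∈ upLabels y ↔ ∃ t ∈ uarcs y, IsPermOfArc t p := by
  constructor
  · rintro ⟨z, hz⟩
    obtain ⟨m, s, h1, h2, hs, rfl, hm⟩ := weakStep_iff.1 (weak_covBy_iff.1 hz.1)
    exact ⟨_, arcAt_mem_uarcs h1 h2 hm, (isEdgeLabel_mul_adj h1 h2 hs hm).1 hz⟩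
  · rintro ⟨t, ht, hp⟩
    obtain ⟨m, hm, rfl⟩ := Finset.mem_image.1 ht
    simp only [Finset.mem_filter, Finset.mem_Ico] at hm
    obtain ⟨⟨h1, h2⟩, hm⟩ := hm
    obtain ⟨s, -, hs⟩ := exists_simpleTransposition h1 h2
    exact ⟨y * s, (isEdgeLabel_mul_adj h1 h2 hs hm).2 hp⟩

theorem eq_of_isPermOfArc_image {A B : Finset Arc} (hA : ∀ t ∈ A, IsArc n t)
    (hB : ∀ t ∈ B, IsArc n t)
    (h : ∀ p : Equiv.Perm (Fin n), (∃ t ∈ A, IsPermOfArc t p) → ∃ t ∈ B, IsPermOfArc t p) :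
    A ⊆ B := by
  intro t ht
  obtain ⟨p, hp, -⟩ := exists_perm_of_isArc (hA t ht)
  obtain ⟨t', ht', hp'⟩ := h p ⟨t, ht, hp⟩
  rwa [(hA t ht).isPermOfArc_inj (hB t' ht') hp hp']

theorem downLabels_eq_upLabels_iff {x y : Equiv.Perm (Fin n)} :
    downLabels x = upLabels y ↔ darcs x = uarcs y := by
  constructor
  · intro h
    have h' : ∀ p : Equiv.Perm (Fin n), (∃ t ∈ darcs x, IsPermOfArc t p) ↔ ∃ t ∈ uarcs y, IsPermOfArc t p := by
      intro p; rw [← mem_downLabels, ← mem_upLabels, h]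
    exact (eq_of_isPermOfArc_image (fun _ => isArc_of_mem_darcs) (fun _ => isArc_of_mem_uarcs)
      fun p => (h' p).1).antisymm
      (eq_of_isPermOfArc_image (fun _ => isArc_of_mem_uarcs) (fun _ => isArc_of_mem_darcs)
      fun p => (h' p).2)
  · intro h
    ext p
    rw [mem_downLabels, mem_upLabels, h]

/-- The label of an edge is join-irreducible. -/
theorem isJoinIrr_of_isEdgeLabel {x y p : Equiv.Perm (Fin n)} (h : IsEdgeLabel x y p) :
    IsJoinIrr p := by
  obtain ⟨hxy, ⟨hlub, hmin⟩⟩ := h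
  have hpx : ¬p ≤ x := by
    intro hp
    have : y ≤ x := hlub.2 (by
      rintro w (rfl | rfl)
      · exact le_rfl
      · exact hp)
    exact hxy.lt.not_ge this
  -- Otherwise `q` would contain the one inversion that `y` has beyond `x`, so its join with `x`
  -- would also be `y`, against the minimality of `p`.
  have hlow : ∀ q, q < p → q ≤ x := by
    intro q hq
    by_contra hqx
    refine hq.not_ge (hmin (?_ : IsLUB {x, q} y))
    refine ⟨?_, fun w hw => ?_⟩
    · rintro w (rfl | rfl)
      · exact hxy.le
      · exact hq.le.trans (hlub.1 (Set.mem_insert_of_mem _ rfl))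
    · obtain ⟨m, s, h1, h2, hs, rfl, hm⟩ := weakStep_iff.1 (weak_covBy_iff.1 hxy)
      have hqy : q ≤ x * s := hq.le.trans (hlub.1 (Set.mem_insert_of_mem _ rfl))
      have h3 := mem_invs_of_not_le hs hm hqy hqx
      rw [weak_le_iff, invs_mul_adj hs hm]
      exact Finset.insert_subset
        (weak_le_iff.1 (hw (Set.mem_insert_of_mem _ rfl)) h3)
        (weak_le_iff.1 (hw (Set.mem_insert _ _)))
  have hcov : ∀ q, q ⋖ p → ∃ e, invs p = insert e (invs q) := by
    intro q hq
    obtain ⟨m, s, -, -, hs, rfl, hm⟩ := weakStep_iff.1 (weak_covBy_iff.1 hq)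
    exact ⟨_, invs_mul_adj hs hm⟩
  have hp1 : p ≠ 1 := by
    rintro rfl
    exact hpx (weak_le_iff.2 (by simp [invs_one]))
  obtain ⟨m, h1, h2, hm⟩ : ∃ m, 1 ≤ m ∧ m < n ∧ ¬permVal p m < permVal p (m + 1) := by
    by_contra! hcon
    exact hp1 (eq_one_of_lt_succ hcon)
  obtain ⟨s, -, hs⟩ := exists_simpleTransposition h1 h2
  have hq : p * s ⋖ p := by
    refine weak_covBy_iff.2 (weakStep_iff.2 ⟨m, s, h1, h2, hs, ?_, ?_⟩)
    · rw [mul_assoc, IsAdj.mul_self hs, mul_one]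
    · rw [permVal_mul_adj_left hs, permVal_mul_adj_right hs]
      exact (permVal_succ_lt_or_gt p m).resolve_left hm
  refine ⟨p * s, hq, fun r hr => ?_⟩
  -- Two distinct lower covers of `p` together contain all inversions of `p`; both lie below `x`,
  -- which would force `p ≤ x`.
  by_contra hne
  obtain ⟨e, he⟩ := hcov _ hq
  have h3 := weak_le_iff.1 (hlow _ hq.lt)
  have h4 := weak_le_iff.1 (hlow _ hr.lt)
  have her : e ∈ invs r := by
    by_contra her
    have h5 : invs r ⊆ invs (p * s) := by
      have := weak_le_iff.1 hr.le
      rw [he] at this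
      exact (Finset.subset_insert_iff_of_notMem her).1 this
    rcases (weak_le_iff.2 h5).eq_or_lt with h6 | h6
    · exact hne h6
    · exact hr.2 h6 hq.lt
  apply hpx
  rw [weak_le_iff, he]
  exact Finset.insert_subset (h4 her) h3

/-! ### Toggleability statistics as conditions on adjacent letters -/

theorem toggleOut_eq (p y : Equiv.Perm (Fin n)) [Decidable (p ∈ downLabels y)] :
    toggleOut p y = if p ∈ downLabels y then 1 else 0 := by
  unfold toggleOut
  congr 1
  rw [eq_iff_iff]
  unfold toggle
  constructor
  · intro h
    split_ifs at h with h1 h2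
    · exact h1
    · exact absurd h.lt h2.choose_spec.1.lt.not_gt
    · exact absurd h.lt (lt_irrefl _)
  · intro h
    have h' : ∃ x, IsEdgeLabel x y p := h
    rw [dif_pos h']
    exact h'.choose_spec.1

/-- At most one summand is nonzero: if `j` immediately precedes `i` in `w`, the positions in `w`
dictate the set `x`. -/
theorem toggleOutPair_eq {i j : ℕ} (h1 : 1 ≤ i) (hij : i < j) (hj : j ≤ n)
    (w : Equiv.Perm (Fin n)) :
    toggleOutPair i j w = if permVal w⁻¹ i = permVal w⁻¹ j + 1 then 1 else 0 := by
  classical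
  unfold toggleOutPair
  simp only [toggleOut_eq]
  rw [← Finset.sum_filter, Finset.filter_filter, Finset.sum_const, nsmul_eq_mul, mul_one]
  split_ifs with h
  · have ht : (i, j, (Finset.Ioo i j).filter fun c => permVal w⁻¹ c < permVal w⁻¹ j) ∈ darcs w :=
      mem_darcs.2 ⟨hij, h, rfl⟩
    obtain ⟨p, hp, -⟩ := exists_perm_of_isArc (isArc_of_mem_darcs ht)
    rw [Finset.card_eq_one.2 ⟨p, ?_⟩]
    · rfl
    ext q
    simp only [Finset.mem_filter, Finset.mem_univ, true_and, Finset.mem_singleton]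
    constructor
    · rintro ⟨⟨-, x, hx, hq⟩, hq'⟩
      obtain ⟨t, ht', htq⟩ := mem_downLabels.1 hq'
      have e := IsArc.isPermOfArc_inj (t' := (i, j, x)) (isArc_of_mem_darcs ht')
        ⟨h1, hij, hj, hx⟩ htq hq
      subst e
      obtain ⟨-, -, e⟩ := mem_darcs.1 ht'
      rw [e] at hq
      exact oneLine_injective (hq.trans hp.symm)
    · rintro rfl
      have hq : q ∈ downLabels w := mem_downLabels.2 ⟨_, ht, hp⟩
      obtain ⟨x, hx⟩ := id hq
      exact ⟨⟨isJoinIrr_of_isEdgeLabel hx, _, Finset.filter_subset _ _, hp⟩, hq⟩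
  · rw [Finset.card_eq_zero.2]
    · rfl
    ext q
    simp only [Finset.mem_filter, Finset.mem_univ, true_and, Finset.notMem_empty, iff_false]
    rintro ⟨⟨-, x, hx, hq⟩, hq'⟩
    obtain ⟨t, ht', htq⟩ := mem_downLabels.1 hq'
    have e := IsArc.isPermOfArc_inj (t' := (i, j, x)) (isArc_of_mem_darcs ht')
      ⟨h1, hij, hj, hx⟩ htq hq
    subst e
    exact h (mem_darcs.1 ht').2.1

/-- Each of the two sums collapses to one term, since a letter has a single left and a single right
neighbour. -/
theorem refinedDownDegree_eq {k : ℕ} (h1 : 1 ≤ k) (hk : k < n) (w : Equiv.Perm (Fin n)) :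
    refinedDownDegree k w = (if permVal w (permVal w⁻¹ k - 1) > k then 1 else 0) +
      if permVal w (permVal w⁻¹ (k + 1) + 1) ≤ k then 1 else 0 := by
  unfold refinedDownDegree
  rw [add_comm]
  have hpos := permVal_pos w⁻¹ h1
  congr 1
  · rw [Finset.sum_congr rfl fun j hj => toggleOutPair_eq h1 (by
      rw [Finset.mem_Icc] at hj; omega) (Finset.mem_Icc.1 hj).2 w]
    have : ∀ j, (permVal w⁻¹ k = permVal w⁻¹ j + 1) ↔ permVal w (permVal w⁻¹ k - 1) = j := by
      intro j
      rw [permVal_eq_iff w]; omega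
    simp only [this]
    rw [Finset.sum_ite_eq]
    have := permVal_le w (a := permVal w⁻¹ k - 1) (by have := permVal_le w⁻¹ hk.le; omega)
    simp only [Finset.mem_Icc, this, and_true]
    rfl
  · rw [Finset.sum_congr rfl fun j hj => toggleOutPair_eq (Finset.mem_Icc.1 hj).1 (by
      rw [Finset.mem_Icc] at hj; omega) (by omega) w]
    have : ∀ j, (permVal w⁻¹ j = permVal w⁻¹ (k + 1) + 1) ↔
        permVal w (permVal w⁻¹ (k + 1) + 1) = j := by
      intro j
      rw [permVal_eq_iff w]; omega
    simp only [this]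
    rw [Finset.sum_ite_eq]
    have := permVal_pos w (a := permVal w⁻¹ (k + 1) + 1) (by omega)
    simp only [Finset.mem_Icc, this, true_and]

end Labels

/-! ### A permutation is determined by the arcs of its descents, and by those of its ascents -/

section ArcInjectivity

variable {n : ℕ}

theorem exists_step_of_pred {P Q : ℕ → Prop} {p q : ℕ} (hpq : p < q) (hp : P p) (hq : Q q)
    (h : ∀ r, p < r → r < q → P r ∨ Q r) : ∃ r, p ≤ r ∧ r < q ∧ P r ∧ Q (r + 1) := by
  obtain ⟨d, rfl⟩ := Nat.exists_eq_add_of_lt hpq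
  clear hpq
  induction d with
  | zero => exact ⟨p, le_rfl, by omega, hp, hq⟩
  | succ d ih =>
    rcases h (p + d + 1) (by omega) (by omega) with h' | h'
    · exact ⟨p + d + 1, by omega, by omega, h', hq⟩
    · obtain ⟨r, h1, h2, h3⟩ := ih h' fun r h1 h2 => h r h1 (by omega)
      exact ⟨r, h1, by omega, h3⟩

theorem mem_darcs_of_adjacent {w : Equiv.Perm (Fin n)} {r : ℕ}
    (h : permVal w (r + 1) < permVal w r) :
    (permVal w (r + 1), permVal w r,
      (Finset.Ioo (permVal w (r + 1)) (permVal w r)).filter fun c => permVal w⁻¹ c < r)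
      ∈ darcs w := by
  rw [mem_darcs]; simp [h]

theorem mem_uarcs_of_adjacent {w : Equiv.Perm (Fin n)} {r : ℕ} (h1 : 1 ≤ r) (h2 : r < n)
    (h : permVal w r < permVal w (r + 1)) :
    (permVal w r, permVal w (r + 1),
      (Finset.Ioo (permVal w r) (permVal w (r + 1))).filter fun c => permVal w⁻¹ c < r)
      ∈ uarcs w := by
  rw [mem_uarcs]; simp [h, permVal_pos w h1, permVal_le w (show r + 1 ≤ n by omega)]

/-- Induction on the distance between `b` and `a` in `y`. A letter between them in both position and
value splits the inversion into two shorter ones. Otherwise every letter on the way is at least `b`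
or at most `a`, so some descent jumps from one kind to the other. In `z` its arc keeps `b` weakly
before its upper end and `a` weakly after its lower end. -/
theorem invs_subset_of_darcs_subset {y z : Equiv.Perm (Fin n)} (h : darcs y ⊆ darcs z) :
    invs y ⊆ invs z := by
  rintro ⟨a, b⟩ hab
  generalize hd : permVal y⁻¹ a - permVal y⁻¹ b = d
  induction d using Nat.strong_induction_on generalizing a b with
  | _ d ih =>
  obtain ⟨hlt, hpos⟩ := mem_invs.1 hab
  refine mem_invs.2 ⟨hlt, ?_⟩
  by_cases hc : ∃ r, permVal y⁻¹ b < r ∧ r < permVal y⁻¹ a ∧ a < permVal y r ∧ permVal y r < b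
  · obtain ⟨r, h1, h2, h3, h4⟩ := hc
    have e1 := mem_invs.1 (ih _ (by simp; omega) (permVal y r) b
      (mem_invs.2 ⟨h4, by simpa using h1⟩) rfl)
    have e2 := mem_invs.1 (ih _ (by simp; omega) a (permVal y r)
      (mem_invs.2 ⟨h3, by simpa using h2⟩) rfl)
    omega
  · push Not at hc
    obtain ⟨r, h1, h2, h3, h4⟩ := exists_step_of_pred (P := fun r => b ≤ permVal y r)
      (Q := fun r => permVal y r ≤ a) hpos (by simp) (by simp) (fun r h1 h2 => by
        by_contra! hcon
        have := hc r h1 h2 hcon.2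
        omega)
    have ht := h (mem_darcs_of_adjacent (by omega : permVal y (r + 1) < permVal y r))
    obtain ⟨-, e1, e2⟩ := mem_darcs.1 ht
    have eb : permVal z⁻¹ b ≤ permVal z⁻¹ (permVal y r) := by
      rcases h3.eq_or_lt with h5 | h5
      · rw [h5]
      have h6 : permVal y⁻¹ b ≠ r := by rintro rfl; simp at h5
      have : b ∈ (Finset.Ioo (permVal y (r + 1)) (permVal y r)).filter
          fun c => permVal y⁻¹ c < r := by
        rw [Finset.mem_filter, Finset.mem_Ioo]; omega
      rw [e2, Finset.mem_filter] at this
      exact this.2.le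
    have ea : permVal z⁻¹ (permVal y (r + 1)) ≤ permVal z⁻¹ a := by
      rcases h4.eq_or_lt with h5 | h5
      · rw [h5]
      have : a ∉ (Finset.Ioo (permVal y (r + 1)) (permVal y r)).filter
          fun c => permVal y⁻¹ c < r := by
        rw [Finset.mem_filter]; omega
      rw [e2, Finset.mem_filter, Finset.mem_Ioo] at this
      have h7 : permVal z⁻¹ a ≠ permVal z⁻¹ (permVal y r) :=
        (permVal_injective _).ne (by omega)
      omega
    omega

/-- The same induction applied to non-inversions, whence the reversed inclusion. -/
theorem invs_subset_of_uarcs_subset {y z : Equiv.Perm (Fin n)} (h : uarcs y ⊆ uarcs z) :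
    invs z ⊆ invs y := by
  have key : ∀ d a b, 1 ≤ a → b ≤ n → a < b → permVal y⁻¹ a < permVal y⁻¹ b →
      permVal y⁻¹ b - permVal y⁻¹ a = d → permVal z⁻¹ a < permVal z⁻¹ b := by
    intro d
    induction d using Nat.strong_induction_on with
    | _ d ih =>
    intro a b ha hb hlt hpos hd
    by_cases hc : ∃ r, permVal y⁻¹ a < r ∧ r < permVal y⁻¹ b ∧ a < permVal y r ∧ permVal y r < b
    · obtain ⟨r, h1, h2, h3, h4⟩ := hc
      have e1 := ih _ (by simp; omega) (permVal y r) b (by omega) hb h4 (by simpa using h2) rfl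
      have e2 := ih _ (by simp; omega) a (permVal y r) ha (by omega) h3 (by simpa using h1) rfl
      omega
    · push Not at hc
      obtain ⟨r, h1, h2, h3, h4⟩ := exists_step_of_pred (P := fun r => permVal y r ≤ a)
        (Q := fun r => b ≤ permVal y r) hpos (by simp) (by simp) (fun r h1 h2 => by
          by_contra! hcon
          have := hc r h1 h2 hcon.1
          omega)
      have hr1 := permVal_pos y⁻¹ ha
      have hr2 := permVal_le y⁻¹ hb
      have ht := h (mem_uarcs_of_adjacent (by omega) (by omega)
        (by omega : permVal y r < permVal y (r + 1)))
      obtain ⟨-, -, -, e1, e2⟩ := mem_uarcs.1 ht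
      have ea : permVal z⁻¹ a ≤ permVal z⁻¹ (permVal y r) := by
        rcases h3.eq_or_lt with h5 | h5
        · rw [h5]
        have h6 : permVal y⁻¹ a ≠ r := by rintro rfl; simp at h5
        have : a ∈ (Finset.Ioo (permVal y r) (permVal y (r + 1))).filter
            fun c => permVal y⁻¹ c < r := by
          rw [Finset.mem_filter, Finset.mem_Ioo]; omega
        rw [e2, Finset.mem_filter] at this
        exact this.2.le
      have eb : permVal z⁻¹ (permVal y (r + 1)) ≤ permVal z⁻¹ b := by
        rcases h4.eq_or_lt with h5 | h5
        · rw [← h5]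
        have : b ∉ (Finset.Ioo (permVal y r) (permVal y (r + 1))).filter
            fun c => permVal y⁻¹ c < r := by
          rw [Finset.mem_filter]; omega
        rw [e2, Finset.mem_filter, Finset.mem_Ioo] at this
        have h7 : permVal z⁻¹ b ≠ permVal z⁻¹ (permVal y r) :=
          (permVal_injective _).ne (by omega)
        omega
      omega
  rintro ⟨a, b⟩ hab
  obtain ⟨hlt, hpos⟩ := mem_invs.1 hab
  obtain ⟨h1, -, h2⟩ := bounds_of_mem_invs hab
  refine mem_invs.2 ⟨hlt, lt_of_le_of_ne (not_lt.1 fun hcon => ?_)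
    ((permVal_injective _).ne hlt.ne')⟩
  have := key _ a b h1 h2 hlt hcon rfl
  omega

theorem darcs_injective : Function.Injective (darcs : Equiv.Perm (Fin n) → Finset Arc) :=
  fun _ _ h => invs_injective ((invs_subset_of_darcs_subset h.subset).antisymm
    (invs_subset_of_darcs_subset h.superset))

theorem uarcs_injective : Function.Injective (uarcs : Equiv.Perm (Fin n) → Finset Arc) :=
  fun _ _ h => invs_injective ((invs_subset_of_uarcs_subset h.superset).antisymm
    (invs_subset_of_uarcs_subset h.subset))

end ArcInjectivity

/-! ### Rearranging descending blocks -/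

section Blocks

/-- The arcs of the ascents of a word, when the letters in `P` precede it. -/
def ascArcs : Finset ℕ → List ℕ → Set Arc
  | P, x :: y :: l => {t | x < y ∧ t = (x, y, Finset.Ioo x y ∩ P)} ∪ ascArcs (insert x P) (y :: l)
  | _, _ => ∅

/-- The arcs of the descents of a word, when the letters in `P` precede it. -/
def descArcs : Finset ℕ → List ℕ → Set Arc
  | P, x :: y :: l => {t | y < x ∧ t = (y, x, Finset.Ioo y x ∩ P)} ∪ descArcs (insert x P) (y :: l)
  | _, _ => ∅

/-- The arcs inside a descending block, when the letters in `P` precede it. -/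
def blockArcs (P : Finset ℕ) : List ℕ → Set Arc
  | x :: y :: l => {(y, x, Finset.Ioo y x ∩ P)} ∪ blockArcs P (y :: l)
  | _ => ∅

/-- The arcs inside the blocks of a list of descending blocks, when the letters in `P` precede
it. -/
def blocksArcs : Finset ℕ → List (List ℕ) → Set Arc
  | _, [] => ∅
  | P, B :: bs => blockArcs P B ∪ blocksArcs (P ∪ B.toFinset) bs

theorem mem_ascArcs {P : Finset ℕ} {l : List ℕ} {a b : ℕ} {S : Finset ℕ} :
    (a, b, S) ∈ ascArcs P l ↔ a < b ∧ ∃ L R, l = L ++ a :: b :: R ∧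
      S = Finset.Ioo a b ∩ (P ∪ L.toFinset) := by
  induction P, l using ascArcs.induct with
  | case1 P x y l ih =>
    rw [ascArcs, Set.mem_union, ih]
    constructor
    · rintro (⟨h, e⟩ | ⟨h, L, R, e, rfl⟩)
      · simp only [Prod.mk.injEq] at e
        obtain ⟨rfl, rfl, rfl⟩ := e
        exact ⟨h, [], l, rfl, by simp⟩
      · refine ⟨h, x :: L, R, by simp [e], ?_⟩
        congr 1
        ext c; simp
    · rintro ⟨h, L, R, e, rfl⟩
      rcases L with _ | ⟨z, L⟩
      · simp only [List.nil_append, List.cons.injEq] at e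
        obtain ⟨rfl, rfl, rfl⟩ := e
        exact Or.inl ⟨h, by simp⟩
      · simp only [List.cons_append, List.cons.injEq] at e
        obtain ⟨rfl, e⟩ := e
        refine Or.inr ⟨h, L, R, e, ?_⟩
        congr 1
        ext c; simp
  | case2 P l hl =>
    rw [ascArcs.eq_2 _ _ hl]
    simp only [Set.mem_empty_iff_false, false_iff]
    rintro ⟨h, L, R, rfl, -⟩
    rcases L with _ | ⟨z, _ | ⟨z', L⟩⟩
    · exact hl _ _ _ rfl
    · exact hl _ _ _ rfl
    · exact hl _ _ _ rfl

theorem mem_descArcs {P : Finset ℕ} {l : List ℕ} {a b : ℕ} {S : Finset ℕ} :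
    (a, b, S) ∈ descArcs P l ↔ a < b ∧ ∃ L R, l = L ++ b :: a :: R ∧
      S = Finset.Ioo a b ∩ (P ∪ L.toFinset) := by
  induction P, l using descArcs.induct with
  | case1 P x y l ih =>
    rw [descArcs, Set.mem_union, ih]
    constructor
    · rintro (⟨h, e⟩ | ⟨h, L, R, e, rfl⟩)
      · simp only [Prod.mk.injEq] at e
        obtain ⟨rfl, rfl, rfl⟩ := e
        exact ⟨h, [], l, rfl, by simp⟩
      · refine ⟨h, x :: L, R, by simp [e], ?_⟩
        congr 1
        ext c; simp
    · rintro ⟨h, L, R, e, rfl⟩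
      rcases L with _ | ⟨z, L⟩
      · simp only [List.nil_append, List.cons.injEq] at e
        obtain ⟨rfl, rfl, rfl⟩ := e
        exact Or.inl ⟨h, by simp⟩
      · simp only [List.cons_append, List.cons.injEq] at e
        obtain ⟨rfl, e⟩ := e
        refine Or.inr ⟨h, L, R, e, ?_⟩
        congr 1
        ext c; simp
  | case2 P l hl =>
    rw [descArcs.eq_2 _ _ hl]
    simp only [Set.mem_empty_iff_false, false_iff]
    rintro ⟨h, L, R, rfl, -⟩
    rcases L with _ | ⟨z, _ | ⟨z', L⟩⟩
    · exact hl _ _ _ rfl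
    · exact hl _ _ _ rfl
    · exact hl _ _ _ rfl

theorem blockArcs_congr {P Q : Finset ℕ} {B : List ℕ}
    (h : ∀ x ∈ B, ∀ y ∈ B, Finset.Ioo y x ∩ P = Finset.Ioo y x ∩ Q) :
    blockArcs P B = blockArcs Q B := by
  induction B using blockArcs.induct with
  | case1 x y l ih =>
    rw [blockArcs, blockArcs, h x (by simp) y (by simp),
      ih fun u hu v hv => h u (by simp [hu]) v (by simp [hv])]
  | case2 l hl => rw [blockArcs.eq_2 _ _ hl, blockArcs.eq_2 _ _ hl]

/-- The letters of `C` do not affect the arcs of `B` if they are all larger or all smaller. -/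
theorem blockArcs_union {P C : Finset ℕ} {B : List ℕ}
    (h : (∀ c ∈ C, ∀ x ∈ B, x ≤ c) ∨ ∀ c ∈ C, ∀ x ∈ B, c ≤ x) :
    blockArcs (P ∪ C) B = blockArcs P B := by
  refine blockArcs_congr fun x hx y hy => ?_
  rw [Finset.inter_union_distrib_left, Finset.union_eq_left]
  intro c hc
  rw [Finset.mem_inter, Finset.mem_Ioo] at hc
  rcases h with h | h
  · have := h c hc.2 x hx; omega
  · have := h c hc.2 y hy; omega

theorem blockArcs_append_pair (P : Finset ℕ) (B : List ℕ) (y x : ℕ) :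
    blockArcs P (B ++ [y, x]) = blockArcs P (B ++ [y]) ∪ {(x, y, Finset.Ioo x y ∩ P)} := by
  induction B with
  | nil => simp [blockArcs]
  | cons u B ih =>
    rcases B with _ | ⟨v, B⟩
    · simp [blockArcs, Set.union_comm]
    · simp only [List.cons_append, blockArcs] at ih ⊢
      rw [ih, Set.union_assoc]

/-- A list of nonempty descending blocks. -/
def IsBlocks (bs : List (List ℕ)) : Prop := ∀ B ∈ bs, B ≠ [] ∧ B.Pairwise (· > ·)

/-- The blocks are the ascending runs, reversed. The first block is written `B ++ [x]` because the
first letter of a run ends its reversal, which is where a new smaller letter must be attached. -/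
theorem exists_blocks_of_cons (l : List ℕ) : ∀ (P : Finset ℕ) (x : ℕ), (x :: l).Nodup →
    ∃ B bs, ((B ++ [x]) :: bs).flatten.Perm (x :: l) ∧ IsBlocks ((B ++ [x]) :: bs) ∧
      blocksArcs P ((B ++ [x]) :: bs) = ascArcs P (x :: l) := by
  induction l with
  | nil =>
    intro P x _
    refine ⟨[], [], by simp, ?_, by simp [blocksArcs, blockArcs, ascArcs]⟩
    simp [IsBlocks]
  | cons y l ih =>
    intro P x hnd
    obtain ⟨B, bs, h1, h2, h3⟩ := ih (insert x P) y hnd.of_cons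
    have hxy : x ≠ y := by rintro rfl; simp at hnd
    have hB := (h2 (B ++ [y]) (by simp)).2
    rcases lt_or_gt_of_ne hxy with hlt | hlt
    · have hBx : ∀ c ∈ B ++ [y], x < c := by
        intro c hc
        rcases List.mem_append.1 hc with hc | hc
        · exact hlt.trans (List.pairwise_append.1 hB |>.2.2 c hc y (by simp))
        · rw [List.mem_singleton.1 hc]; exact hlt
      refine ⟨B ++ [y], bs, ?_, ?_, ?_⟩
      · have : ((B ++ [y] ++ [x]) :: bs).flatten = (B ++ [y]) ++ x :: bs.flatten := by simp
        rw [this]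
        refine List.perm_middle.trans ?_
        rw [List.perm_cons]
        simpa using h1
      · intro C hC
        rcases List.mem_cons.1 hC with rfl | hC
        · refine ⟨by simp, ?_⟩
          rw [List.pairwise_append]
          exact ⟨hB, by simp, fun c hc d hd => by
            rw [List.mem_singleton.1 hd]; exact hBx c hc⟩
        · exact h2 C (by simp [hC])
      -- The new letter is below the whole block, so it lies in none of the intervals of its arcs.
      · have e1 : blockArcs (insert x P) (B ++ [y]) = blockArcs P (B ++ [y]) := by
          rw [Finset.insert_eq, Finset.union_comm]
          refine blockArcs_union (Or.inr fun c hc z hz => ?_)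
          rw [Finset.mem_singleton.1 hc]; exact (hBx z hz).le
        have e2 : insert x P ∪ (B ++ [y]).toFinset = P ∪ (B ++ [y] ++ [x]).toFinset := by
          ext c; simp
        have e3 : {t : Arc | x < y ∧ t = (x, y, Finset.Ioo x y ∩ P)} =
            {(x, y, Finset.Ioo x y ∩ P)} := by ext t; simp [hlt]
        rw [ascArcs, ← h3, blocksArcs, blocksArcs, e1, e2, e3, List.append_assoc,
          show [y] ++ [x] = [y, x] from rfl, blockArcs_append_pair, ← Set.union_assoc,
          Set.union_comm {_}]
    · refine ⟨[], (B ++ [y]) :: bs, ?_, ?_, ?_⟩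
      · have : (([] ++ [x]) :: (B ++ [y]) :: bs).flatten = x :: ((B ++ [y]) :: bs).flatten := by
          simp
        rw [this, List.perm_cons]
        exact h1
      · intro C hC
        rcases List.mem_cons.1 hC with rfl | hC
        · simp
        · exact h2 C hC
      · have e3 : {t : Arc | x < y ∧ t = (x, y, Finset.Ioo x y ∩ P)} = ∅ := by
          ext t; simp [hlt.le]
        rw [ascArcs, ← h3, blocksArcs, e3, Set.empty_union]
        have : P ∪ ([] ++ [x]).toFinset = insert x P := by ext c; simp
        rw [this]
        simp [blockArcs]

theorem exists_blocks (l : List ℕ) (hl : l.Nodup) :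
    ∃ bs, bs.flatten.Perm l ∧ IsBlocks bs ∧ blocksArcs ∅ bs = ascArcs ∅ l := by
  rcases l with _ | ⟨x, l⟩
  · exact ⟨[], by simp, by simp [IsBlocks], by simp [blocksArcs, ascArcs]⟩
  · obtain ⟨B, bs, h⟩ := exists_blocks_of_cons l ∅ x hl
    exact ⟨_, h⟩

/-- No letter of one block lies strictly between two letters of the other, so their relative order
affects no arc. -/
theorem blocksArcs_swap {B C : List ℕ} (h : ∀ u ∈ B, ∀ v ∈ C, v ≤ u) (Y : List (List ℕ)) :
    ∀ (X : List (List ℕ)) (P : Finset ℕ),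
      blocksArcs P (X ++ C :: B :: Y) = blocksArcs P (X ++ B :: C :: Y) := by
  intro X
  induction X with
  | nil =>
    intro P
    simp only [List.nil_append, blocksArcs]
    rw [blockArcs_union (C := C.toFinset), blockArcs_union (C := B.toFinset),
      Set.union_left_comm, Finset.union_right_comm]
    · exact Or.inl fun c hc x hx => h c (List.mem_toFinset.1 hc) x hx
    · exact Or.inr fun c hc x hx => h x hx c (List.mem_toFinset.1 hc)
  | cons A X ih =>
    intro P
    simp only [List.cons_append, blocksArcs, ih]

/-- Earlier letters of a descending block exceed all later ones, so using `P` for every arc of the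
block loses nothing; the ascent at the boundary contributes no arc. -/
theorem descArcs_append {B l : List ℕ} (hB : B ≠ []) (hd : B.Pairwise (· > ·))
    (hl : ∀ u ∈ B.getLast?, ∀ v ∈ l.head?, u < v) : ∀ P : Finset ℕ,
      descArcs P (B ++ l) = blockArcs P B ∪ descArcs (P ∪ B.toFinset) l := by
  induction B with
  | nil => exact absurd rfl hB
  | cons x B ih =>
    intro P
    have eP : P ∪ {x} = insert x P := by ext c; simp
    rcases B with _ | ⟨y, B⟩
    · rcases l with _ | ⟨y, l⟩
      · simp [descArcs, blockArcs]
      · have hxy : x < y := hl x (by simp) y (by simp)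
        have e : {t : Arc | y < x ∧ t = (y, x, Finset.Ioo y x ∩ P)} = ∅ := by
          ext t; simp [hxy.le]
        simp only [List.cons_append, List.nil_append, descArcs, e, blockArcs, Set.empty_union,
          List.toFinset_cons, List.toFinset_nil, insert_empty_eq, eP]
    · have hd' := List.pairwise_cons.1 hd
      have hyx : y < x := hd'.1 y (by simp)
      have e : {t : Arc | y < x ∧ t = (y, x, Finset.Ioo y x ∩ P)} =
          {(y, x, Finset.Ioo y x ∩ P)} := by ext t; simp [hyx]
      have ih := ih (by simp) hd'.2 (by simpa using hl) (insert x P)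
      rw [List.cons_append] at ih
      rw [List.cons_append, List.cons_append, descArcs, ih, e, blockArcs, ← eP,
        blockArcs_union (Or.inl fun c hc z hz => ?_), Set.union_assoc]
      · congr 3
        ext c; simp; tauto
      · rw [Finset.mem_singleton.1 hc]; exact (hd'.1 z hz).le

theorem descArcs_flatten {bs : List (List ℕ)} (hbs : IsBlocks bs)
    (hch : bs.IsChain fun B C => ∀ u ∈ B.getLast?, ∀ v ∈ C.head?, u < v) :
    ∀ P : Finset ℕ, descArcs P bs.flatten = blocksArcs P bs := by
  induction bs with
  | nil => intro P; simp [descArcs, blocksArcs]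
  | cons B bs ih =>
    intro P
    have hB := hbs B (by simp)
    rw [List.flatten_cons, descArcs_append hB.1 hB.2, blocksArcs,
      ih (fun C hC => hbs C (by simp [hC])) hch.tail]
    rcases bs with _ | ⟨C, bs⟩
    · simp
    · intro u hu v hv
      have hC := hbs C (by simp)
      refine (List.isChain_cons_cons.1 hch).1 u hu v ?_
      rw [List.flatten_cons, List.head?_append_of_ne_nil _ hC.1] at hv
      exact hv

theorem exists_descArcs_eq_ascArcs (l₀ : List ℕ) (h₀ : l₀.Nodup) :
    ∃ l : List ℕ, l.Perm l₀ ∧ descArcs ∅ l = ascArcs ∅ l₀ := by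
  let A : Set (List ℕ) := {l | l.Perm l₀ ∧ ∃ bs : List (List ℕ), bs.flatten = l ∧ IsBlocks bs ∧
    blocksArcs ∅ bs = ascArcs ∅ l₀}
  have hfin : A.Finite := (List.finite_toSet l₀.permutations).subset fun l hl =>
    List.mem_permutations.2 hl.1
  have hne : A.Nonempty := by
    obtain ⟨bs, h1, h2⟩ := exists_blocks l₀ h₀
    exact ⟨_, h1, bs, rfl, h2⟩
  obtain ⟨l, ⟨hl, bs, rfl, hbs, harcs⟩, hmin⟩ := hfin.exists_minimal hne
  refine ⟨_, hl, ?_⟩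
  rw [← harcs]
  refine descArcs_flatten hbs ?_ _
  rw [List.isChain_iff_forall_rel_of_append_cons_cons]
  intro B C X Y hXY u hu v hv
  subst hXY
  by_contra hvu
  have hB := hbs B (by simp)
  have hC := hbs C (by simp)
  obtain ⟨B', rfl⟩ := List.getLast?_eq_some_iff.1 hu
  obtain ⟨C', rfl⟩ := List.head?_eq_some_iff.1 hv
  have hnd : (X ++ (B' ++ [u]) :: (v :: C') :: Y).flatten.Nodup := hl.nodup_iff.2 h₀
  have huv : v < u := by
    refine lt_of_le_of_ne (not_lt.1 hvu) ?_
    rintro rfl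
    simp only [List.flatten_append, List.flatten_cons] at hnd
    have := (List.nodup_append.1 hnd).2.1
    exact (List.nodup_append.1 this).2.2 v (by simp) v (by simp) rfl
  have h1 : ∀ c ∈ B' ++ [u], u ≤ c := by
    intro c hc
    rcases List.mem_append.1 hc with hc | hc
    · exact ((List.pairwise_append.1 hB.2).2.2 c hc u (by simp)).le
    · rw [List.mem_singleton.1 hc]
  have h2 : ∀ d ∈ v :: C', d ≤ v := by
    intro d hd
    rcases List.mem_cons.1 hd with rfl | hd
    · exact le_rfl
    · exact ((List.pairwise_cons.1 hC.2).1 d hd).le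
  -- A descent `u > v` at the boundary separates the blocks, since `u` is least in its block and `v`
  -- greatest in its own. Exchanging them keeps the arcs and gives a lexicographically smaller word.
  have hlt : (X ++ (v :: C') :: (B' ++ [u]) :: Y).flatten <
      (X ++ (B' ++ [u]) :: (v :: C') :: Y).flatten := by
    simp only [List.flatten_append, List.flatten_cons]
    refine List.append_left_lt ?_
    obtain ⟨z, Z, hz⟩ := List.exists_cons_of_ne_nil (show B' ++ [u] ≠ [] by simp)
    rw [hz, List.cons_append, List.cons_append, List.cons_append, List.cons_lt_cons_iff]
    left
    have := h1 z (by rw [hz]; simp)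
    omega
  refine hlt.not_ge (hmin ⟨?_, _, rfl, ?_, ?_⟩ hlt.le)
  · refine List.Perm.trans ?_ hl
    refine List.Perm.flatten ?_
    exact (List.Perm.swap _ _ _).append_left X
  · intro D hD
    apply hbs
    simp only [List.mem_append, List.mem_cons] at hD ⊢
    tauto
  · rw [blocksArcs_swap, harcs]
    intro c hc d hd
    have := h1 c hc; have := h2 d hd; omega

/-! ### From words back to permutations -/

variable {n : ℕ}

theorem length_oneLine (w : Equiv.Perm (Fin n)) : (oneLine w).length = n := by simp [oneLine]

theorem getElem_oneLine (w : Equiv.Perm (Fin n)) {i : ℕ} (hi : i < (oneLine w).length) :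
    (oneLine w)[i] = permVal w (i + 1) := by
  rw [length_oneLine] at hi
  have := permVal_fin w ⟨i, hi⟩
  simp only at this
  rw [this]
  simp [oneLine]

theorem nodup_oneLine (w : Equiv.Perm (Fin n)) : (oneLine w).Nodup := by
  rw [oneLine, List.nodup_ofFn]
  intro i j h
  have : (w i : ℕ) = w j := by simpa using h
  exact w.injective (Fin.ext this)

theorem mem_of_oneLine_eq_append {w : Equiv.Perm (Fin n)} {L R : List ℕ}
    (h : oneLine w = L ++ R) (c : ℕ) : c ∈ L ↔ 1 ≤ c ∧ permVal w⁻¹ c ≤ L.length := by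
  have hlen : L.length ≤ n := by
    rw [← length_oneLine w, h]; simp
  constructor
  · intro hc
    obtain ⟨i, hi, rfl⟩ := List.getElem_of_mem hc
    have e : L[i] = permVal w (i + 1) := by
      rw [← getElem_oneLine w (by rw [length_oneLine]; omega)]
      simp [h, List.getElem_append_left hi]
    rw [e]
    simp only [permVal_inv_apply]
    exact ⟨permVal_pos w (by omega), hi⟩
  · rintro ⟨h1, h2⟩
    have h3 := permVal_pos w⁻¹ h1
    have h4 := getElem_oneLine w (i := permVal w⁻¹ c - 1) (by rw [length_oneLine]; omega)
    rw [Nat.sub_add_cancel h3, permVal_apply_inv] at h4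
    rw [← h4]
    simp only [h]
    rw [List.getElem_append_left (by omega)]
    exact List.getElem_mem _

/-- The condition on `I` excludes `0`, which has position `0` under `permVal` but is not a letter of
the word. -/
theorem oneLine_eq_append_pair_iff {w : Equiv.Perm (Fin n)} {x y : ℕ} {I S : Finset ℕ}
    (hI : ∀ c ∈ I, 1 ≤ c) :
    (∃ L R, oneLine w = L ++ x :: y :: R ∧ S = I ∩ (∅ ∪ L.toFinset)) ↔
      (1 ≤ x ∧ y ≤ n) ∧ permVal w⁻¹ y = permVal w⁻¹ x + 1 ∧
        S = I.filter fun c => permVal w⁻¹ c < permVal w⁻¹ x := by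
  have key : ∀ L : List ℕ, (∀ c, c ∈ L ↔ 1 ≤ c ∧ permVal w⁻¹ c ≤ L.length) →
      permVal w⁻¹ x = L.length + 1 →
      I ∩ (∅ ∪ L.toFinset) = I.filter fun c => permVal w⁻¹ c < permVal w⁻¹ x := by
    intro L hL hx
    ext c
    simp only [Finset.empty_union, Finset.mem_inter, List.mem_toFinset, Finset.mem_filter,
      and_congr_right_iff, hL, hx]
    intro hc
    have := hI c hc
    omega
  constructor
  · rintro ⟨L, R, h, rfl⟩
    have hlen : L.length + 2 ≤ n := by
      rw [← length_oneLine w, h]; simp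
    have hx : permVal w (L.length + 1) = x := by
      rw [← getElem_oneLine w (by rw [length_oneLine]; omega)]; simp [h]
    have hy : permVal w (L.length + 1 + 1) = y := by
      rw [← getElem_oneLine w (by rw [length_oneLine]; omega)]; simp [h]
    refine ⟨⟨?_, ?_⟩, ?_, key L (mem_of_oneLine_eq_append h) ?_⟩
    · rw [← hx]; exact permVal_pos w (by omega)
    · rw [← hy]; exact permVal_le w (by omega)
    · rw [← hx, ← hy]; simp
    · rw [← hx]; simp
  · rintro ⟨⟨h1, h2⟩, h3, rfl⟩
    have h4 := permVal_pos w⁻¹ h1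
    have h5 := permVal_le w⁻¹ h2
    have hl := length_oneLine w
    have e : oneLine w = (oneLine w).take (permVal w⁻¹ x - 1) ++
        x :: y :: (oneLine w).drop (permVal w⁻¹ x + 1) := by
      conv_lhs => rw [← List.take_append_drop (permVal w⁻¹ x - 1) (oneLine w)]
      congr 1
      rw [List.drop_eq_getElem_cons (by omega), List.drop_eq_getElem_cons (by omega),
        getElem_oneLine, getElem_oneLine, Nat.sub_add_cancel h4, permVal_apply_inv,
        (by rw [← h3]; simp : permVal w (permVal w⁻¹ x + 1) = y)]
    refine ⟨_, _, e, (key _ (mem_of_oneLine_eq_append e) ?_).symm⟩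
    rw [List.length_take]
    omega

theorem descArcs_oneLine (w : Equiv.Perm (Fin n)) : descArcs ∅ (oneLine w) = darcs w := by
  ext ⟨a, b, S⟩
  rw [mem_descArcs, Finset.mem_coe, mem_darcs,
    oneLine_eq_append_pair_iff (by intro c hc; rw [Finset.mem_Ioo] at hc; omega)]
  constructor
  · rintro ⟨h1, -, h2⟩
    exact ⟨h1, h2⟩
  · rintro ⟨h1, h2, h3⟩
    have := bounds_of_mem_invs (mem_invs.2 ⟨h1, (by omega : permVal w⁻¹ b < permVal w⁻¹ a)⟩)
    exact ⟨h1, ⟨by omega, by omega⟩, h2, h3⟩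

theorem ascArcs_oneLine (w : Equiv.Perm (Fin n)) : ascArcs ∅ (oneLine w) = uarcs w := by
  ext ⟨a, b, S⟩
  rw [mem_ascArcs, Finset.mem_coe, mem_uarcs,
    oneLine_eq_append_pair_iff (by intro c hc; rw [Finset.mem_Ioo] at hc; omega)]
  tauto

theorem exists_darcs_eq_uarcs (y : Equiv.Perm (Fin n)) :
    ∃ x : Equiv.Perm (Fin n), darcs x = uarcs y := by
  obtain ⟨l, h1, h2⟩ := exists_descArcs_eq_ascArcs (oneLine y) (nodup_oneLine y)
  obtain ⟨x, rfl⟩ := exists_oneLine_eq (n := n) (h1.nodup_iff.2 (nodup_oneLine y))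
    (fun c => by rw [h1.mem_iff, mem_oneLine])
  refine ⟨x, ?_⟩
  rwa [descArcs_oneLine, ascArcs_oneLine, Finset.coe_inj] at h2

end Blocks

/-! ### Homomesy -/

section Mesic

variable {n : ℕ}

/-- Weights of arcs whose signed sum over the edges at `w` is `refinedDownDegree k w - 1`. -/
def arcWeight (k : ℕ) (t : Arc) : ℤ :=
  (if t.1 < k ∧ k + 1 < t.2.1 ∧ k + 1 ∈ t.2.2 ∧ k ∉ t.2.2 then 1 else 0) -
    if t.1 ≤ k ∧ k + 1 ≤ t.2.1 ∧ (t.1 = k ∨ k ∈ t.2.2) ∧ (t.2.1 = k + 1 ∨ k + 1 ∉ t.2.2)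
      then 1 else 0

theorem sum_darcs (w : Equiv.Perm (Fin n)) (f : Arc → ℤ) :
    ∑ t ∈ darcs w, f t =
      ∑ m ∈ Finset.Ico 1 n, if permVal w (m + 1) < permVal w m then f (arcAt w m) else 0 := by
  rw [darcs, Finset.sum_image, Finset.sum_filter]
  intro m hm m' hm' h
  simp only [Finset.coe_filter, Set.mem_ofPred_eq] at hm hm'
  have := congrArg (fun t : Arc => t.2.1) h
  simp only [arcAt, max_eq_left hm.2.le, max_eq_left hm'.2.le] at this
  exact permVal_injective w this

theorem sum_uarcs (w : Equiv.Perm (Fin n)) (f : Arc → ℤ) :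
    ∑ t ∈ uarcs w, f t =
      ∑ m ∈ Finset.Ico 1 n, if permVal w m < permVal w (m + 1) then f (arcAt w m) else 0 := by
  rw [uarcs, Finset.sum_image, Finset.sum_filter]
  intro m hm m' hm' h
  simp only [Finset.coe_filter, Set.mem_ofPred_eq] at hm hm'
  have := congrArg (fun t : Arc => t.1) h
  simp only [arcAt, min_eq_left hm.2.le, min_eq_left hm'.2.le] at this
  exact permVal_injective w this

/-- The indicator of the positions of the letters above `k`. -/
def aboveInd (k : ℕ) (w : Equiv.Perm (Fin n)) (m : ℕ) : ℤ := if k < permVal w m then 1 else 0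

/-- With `k` left of `k + 1`, only the negative part of the weight can occur: it selects the
crossing edges with `k` weakly to the left and `k + 1` weakly to the right. The sign of ascent minus
descent is the increment of `aboveInd`. -/
theorem signed_arcWeight_of_lt {k : ℕ} {w : Equiv.Perm (Fin n)}
    (hPQ : permVal w⁻¹ k < permVal w⁻¹ (k + 1)) (m : ℕ) :
    ((if permVal w m < permVal w (m + 1) then arcWeight k (arcAt w m) else 0) -
      if permVal w (m + 1) < permVal w m then arcWeight k (arcAt w m) else 0) =
    if permVal w⁻¹ k ≤ m + 1 ∧ m ≤ permVal w⁻¹ (k + 1) then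
      -(aboveInd k w (m + 1) - aboveInd k w m) else 0 := by
  have e1 := permVal_eq_iff w m k
  have e2 := permVal_eq_iff w m (k + 1)
  have e3 := permVal_eq_iff w (m + 1) k
  have e4 := permVal_eq_iff w (m + 1) (k + 1)
  rcases permVal_succ_lt_or_gt w m with h | h
  · rw [if_pos h, if_neg h.not_gt]
    simp only [arcWeight, arcAt, min_eq_left h.le, max_eq_right h.le, Finset.mem_filter,
      Finset.mem_Ioo, aboveInd]
    generalize permVal w m = u at *
    generalize permVal w (m + 1) = v at *
    generalize permVal w⁻¹ k = P at *
    generalize permVal w⁻¹ (k + 1) = Q at *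
    split_ifs <;> omega
  · rw [if_pos h, if_neg h.not_gt]
    simp only [arcWeight, arcAt, min_eq_right h.le, max_eq_left h.le, Finset.mem_filter,
      Finset.mem_Ioo, aboveInd]
    generalize permVal w m = u at *
    generalize permVal w (m + 1) = v at *
    generalize permVal w⁻¹ k = P at *
    generalize permVal w⁻¹ (k + 1) = Q at *
    split_ifs <;> omega

/-- With `k + 1` left of `k`, the positive part selects the crossing edges strictly between them.
The negative part survives only on the edge joining `k + 1` to an adjacent `k`; this is the last
summand. -/
theorem signed_arcWeight_of_gt {k : ℕ} {w : Equiv.Perm (Fin n)}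
    (hPQ : permVal w⁻¹ (k + 1) < permVal w⁻¹ k) (m : ℕ) :
    ((if permVal w m < permVal w (m + 1) then arcWeight k (arcAt w m) else 0) -
      if permVal w (m + 1) < permVal w m then arcWeight k (arcAt w m) else 0) =
    (if permVal w⁻¹ (k + 1) + 1 ≤ m ∧ m < permVal w⁻¹ k - 1 then
      aboveInd k w (m + 1) - aboveInd k w m else 0) +
      if m = permVal w⁻¹ (k + 1) then
        if permVal w⁻¹ k = permVal w⁻¹ (k + 1) + 1 then 1 else 0 else 0 := by
  have e1 := permVal_eq_iff w m k
  have e2 := permVal_eq_iff w m (k + 1)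
  have e3 := permVal_eq_iff w (m + 1) k
  have e4 := permVal_eq_iff w (m + 1) (k + 1)
  rcases permVal_succ_lt_or_gt w m with h | h
  · rw [if_pos h, if_neg h.not_gt]
    simp only [arcWeight, arcAt, min_eq_left h.le, max_eq_right h.le, Finset.mem_filter,
      Finset.mem_Ioo, aboveInd]
    generalize permVal w m = u at *
    generalize permVal w (m + 1) = v at *
    generalize permVal w⁻¹ k = P at *
    generalize permVal w⁻¹ (k + 1) = Q at *
    split_ifs <;> omega
  · rw [if_pos h, if_neg h.not_gt]
    simp only [arcWeight, arcAt, min_eq_right h.le, max_eq_left h.le, Finset.mem_filter,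
      Finset.mem_Ioo, aboveInd]
    generalize permVal w m = u at *
    generalize permVal w (m + 1) = v at *
    generalize permVal w⁻¹ k = P at *
    generalize permVal w⁻¹ (k + 1) = Q at *
    split_ifs <;> omega

theorem sum_Ico_succ_sub (f : ℕ → ℤ) {a b : ℕ} (h : a ≤ b) :
    ∑ m ∈ Finset.Ico a b, (f (m + 1) - f m) = f b - f a := by
  induction b, h using Nat.le_induction with
  | base => simp
  | succ b h ih => rw [Finset.sum_Ico_succ_top h, ih]; ring

theorem sum_uarcs_sub_sum_darcs {k : ℕ} (h1 : 1 ≤ k) (hk : k < n) (w : Equiv.Perm (Fin n)) :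
    ∑ t ∈ uarcs w, arcWeight k t - ∑ t ∈ darcs w, arcWeight k t =
      refinedDownDegree k w - 1 := by
  have hP := permVal_pos w⁻¹ h1
  have hP' := permVal_le w⁻¹ hk.le
  have hQ := permVal_pos w⁻¹ (by omega : 1 ≤ k + 1)
  have hQ' := permVal_le w⁻¹ (by omega : k + 1 ≤ n)
  have hf : refinedDownDegree k w - 1 =
      aboveInd k w (permVal w⁻¹ k - 1) - aboveInd k w (permVal w⁻¹ (k + 1) + 1) := by
    rw [refinedDownDegree_eq h1 hk, aboveInd, aboveInd]
    split_ifs <;> omega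
  rw [hf, sum_uarcs, sum_darcs, ← Finset.sum_sub_distrib]
  rcases lt_or_gt_of_ne ((permVal_injective w⁻¹).ne (by omega : k ≠ k + 1)) with h | h
  · rw [Finset.sum_congr rfl fun m _ => signed_arcWeight_of_lt h m, ← Finset.sum_filter,
      Finset.sum_subset (s₂ := Finset.Ico (permVal w⁻¹ k - 1) (permVal w⁻¹ (k + 1) + 1)),
      Finset.sum_neg_distrib, sum_Ico_succ_sub _ (by omega)]
    · ring
    · intro m hm
      rw [Finset.mem_filter, Finset.mem_Ico] at hm
      rw [Finset.mem_Ico]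
      omega
    · intro m hm hm'
      rw [Finset.mem_Ico] at hm
      rw [Finset.mem_filter, Finset.mem_Ico] at hm'
      -- The telescoping range may overshoot the genuine edges at either end; by the values at `0`
      -- and `n + 1` the extra increments vanish.
      have hm0 : m = 0 ∧ permVal w⁻¹ k = 1 ∨ m = n ∧ permVal w⁻¹ (k + 1) = n := by omega
      rcases hm0 with ⟨rfl, h3⟩ | ⟨rfl, h3⟩
      · have : permVal w (0 + 1) = k := by rw [← h3]; simp
        simp [aboveInd, this]
      · have e1 : permVal w m = k + 1 := by rw [permVal_eq_iff]; exact h3.symm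
        have e2 := permVal_gt w (by omega : m < m + 1)
        simp [aboveInd, e1, e2]
        omega
  · rw [Finset.sum_congr rfl fun m _ => signed_arcWeight_of_gt h m, Finset.sum_add_distrib,
      Finset.sum_ite_eq', ← Finset.sum_filter]
    have e : (Finset.Ico 1 n).filter
        (fun m => permVal w⁻¹ (k + 1) + 1 ≤ m ∧ m < permVal w⁻¹ k - 1) =
        Finset.Ico (permVal w⁻¹ (k + 1) + 1) (permVal w⁻¹ k - 1) := by
      ext m
      rw [Finset.mem_filter, Finset.mem_Ico, Finset.mem_Ico]
      omega
    rw [e, if_pos (by rw [Finset.mem_Ico]; omega)]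
    by_cases hadj : permVal w⁻¹ k = permVal w⁻¹ (k + 1) + 1
    · rw [if_pos hadj, hadj, Finset.Ico_eq_empty (by omega), Finset.sum_empty, ← hadj,
        hadj, Nat.add_sub_cancel, aboveInd, aboveInd, ← hadj, permVal_apply_inv, permVal_apply_inv]
      simp
    · rw [if_neg hadj, sum_Ico_succ_sub _ (by omega), add_zero]

/-! ### Rowmotion and sums over its orbits -/

theorem existsUnique_downLabels_eq_upLabels (y : Equiv.Perm (Fin n)) :
    ∃! x : Equiv.Perm (Fin n), downLabels x = upLabels y := by
  obtain ⟨x, hx⟩ := exists_darcs_eq_uarcs y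
  refine ⟨x, downLabels_eq_upLabels_iff.2 hx, fun z hz => ?_⟩
  exact darcs_injective ((downLabels_eq_upLabels_iff.1 hz).trans hx.symm)

theorem darcs_rowmotion (y : Equiv.Perm (Fin n)) : darcs (rowmotion y) = uarcs y := by
  have h : ∃ x : Equiv.Perm (Fin n), downLabels x = upLabels y :=
    (existsUnique_downLabels_eq_upLabels y).exists
  rw [rowmotion, dif_pos h]
  exact downLabels_eq_upLabels_iff.1 h.choose_spec

theorem rowmotion_bijective :
    Function.Bijective (rowmotion : Equiv.Perm (Fin n) → Equiv.Perm (Fin n)) := by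
  refine Finite.injective_iff_bijective.1 fun y z h => uarcs_injective ?_
  rw [← darcs_rowmotion, ← darcs_rowmotion, h]

theorem IsOrbit.nonempty {X : Type*} {Φ : X → X} {O : Finset X} (hO : IsOrbit Φ O) :
    O.Nonempty := by
  obtain ⟨x, hx⟩ := hO
  exact ⟨x, (hx x).2 ⟨0, rfl⟩⟩

/-- A finite forward orbit is mapped into itself, hence by injectivity onto itself. -/
theorem IsOrbit.sum_comp {X : Type*} {Φ : X → X} (hΦ : Function.Injective Φ) {O : Finset X}
    (hO : IsOrbit Φ O) (f : X → ℤ) : ∑ y ∈ O, f (Φ y) = ∑ y ∈ O, f y := by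
  classical
  obtain ⟨x, hx⟩ := hO
  have himg : O.image Φ = O := by
    refine Finset.eq_of_subset_of_card_le ?_ (Finset.card_image_of_injective _ hΦ).ge
    intro z hz
    obtain ⟨y, hy, rfl⟩ := Finset.mem_image.1 hz
    obtain ⟨m, rfl⟩ := (hx y).1 hy
    exact (hx _).2 ⟨m + 1, Function.iterate_succ_apply' _ _ _⟩
  conv_rhs => rw [← himg, Finset.sum_image hΦ.injOn]

theorem sum_refinedDownDegree {k : ℕ} (h1 : 1 ≤ k) (hk : k < n)
    {O : Finset (Equiv.Perm (Fin n))} (hO : IsOrbit rowmotion O) :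
    ∑ w ∈ O, refinedDownDegree k w = O.card := by
  have h := hO.sum_comp rowmotion_bijective.injective
    fun w => ∑ t ∈ darcs w, arcWeight k t
  simp only [darcs_rowmotion] at h
  rw [← sub_eq_zero, ← Finset.sum_sub_distrib,
    Finset.sum_congr rfl fun w _ => sum_uarcs_sub_sum_darcs h1 hk w, Finset.sum_sub_distrib] at h
  simp only [Finset.sum_const, nsmul_eq_mul, mul_one] at h
  omega

end Mesic

theorem corollary5p10 (n : ℕ) :
    (∀ y : Equiv.Perm (Fin n), ∃! x : Equiv.Perm (Fin n), downLabels x = upLabels y) ∧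
    ∀ k : ℕ, 1 ≤ k → k < n →
      IsMesic (rowmotion : Equiv.Perm (Fin n) → Equiv.Perm (Fin n))
        (fun w => (refinedDownDegree k w : ℝ)) 1 ∧
      ∀ O : Finset (Equiv.Perm (Fin n)), IsOrbit rowmotion O →
        (O.filter fun w => permVal w (permVal w⁻¹ k - 1) > k).card =
        (O.filter fun w => permVal w (permVal w⁻¹ (k + 1) + 1) > k + 1).card := by
  refine ⟨existsUnique_downLabels_eq_upLabels, fun k h1 hk =>
    ⟨⟨rowmotion_bijective, fun O hO => ?_⟩, fun O hO => ?_⟩⟩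
  · rw [← Int.cast_sum, sum_refinedDownDegree h1 hk hO, Int.cast_natCast,
      div_self (Nat.cast_ne_zero.2 hO.nonempty.card_ne_zero)]
  · have h := sum_refinedDownDegree h1 hk hO
    -- The right neighbour of `k + 1` is not `k + 1`, so the second indicator of the statistic marks
    -- the complement of the ascents.
    have hle : ∀ w : Equiv.Perm (Fin n), permVal w (permVal w⁻¹ (k + 1) + 1) ≤ k ↔
        ¬permVal w (permVal w⁻¹ (k + 1) + 1) > k + 1 := by
      intro w
      have : permVal w (permVal w⁻¹ (k + 1) + 1) ≠ k + 1 := by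
        rw [Ne, permVal_eq_iff]; omega
      omega
    simp only [refinedDownDegree_eq h1 hk, Finset.sum_add_distrib, ← Finset.sum_filter,
      hle, Finset.sum_const, nsmul_eq_mul, mul_one] at h
    have hc := Finset.card_filter_add_card_filter_not (s := O)
      (fun w => permVal w (permVal w⁻¹ (k + 1) + 1) > k + 1)
    omega
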